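/- Let $n\ge 1$ be an integer, $a_0,a_1\in\mathbb{R}$ and $h=\frac{1}{2^n-1}$. Let $A_{n,3}$ be the $2^n\times 2^n$ real matrix (the normalized 1-D Neumann/Robin ghost-point Laplacian) whose entries, indexed by $0\le i,j\le 2^n-1$, are: $-2+2a_0h$ at $(0,0)$; $-2-2a_1h$ at $(2^n-1,2^n-1)$; $-2$ at all other diagonal positions; $2$ at $(0,1)$ and at $(2^n-1,2^n-2)$; $1$ at all other positions with $|i-j|=1$; and $0$ elsewhere. Thus $A_{n,3}=h^2L_{n,3}$, where $L_{n,3}$ is the second-order ghost-point discretization of $u''$ on $(0,1)$ with the boundary conditions $u'(0)+a_0u(0)=b_0$, $u'(1)+a_1u(1)=b_1$ on the grid $x_i=ih$. Let $I$ be the $2\times2$ identity, $X=\begin{pmatrix}0&1\\1&0\end{pmatrix}$, $Z=\begin{pmatrix}1&0\\0&-1\end{pmatrix}$; let $S_n$ be the $2^n\times2^n$ increment matrix $S_n e_j=e_{(j+1)\bmod 2^n}$; and let $C_n^-$ be the $2^n\times2^n$ matrix supported on the antidiagonal $i+j=2^n-1$, with entry $1$ at the two corners $(0,2^n-1)$ and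 $(2^n-1,0)$ and $-1$ at all other antidiagonal positions. Then \begin{align*} A_{n,3} &= \frac{-4+(a_0-a_1)h}{2}\,I^{\otimes n}+\frac12\, I^{\otimes n-1}\otimes X-\frac12\, X^{\otimes n}+\frac{(a_0+a_1)h}{2}\,I^{\otimes n-1}\otimes Z+S_n+S_n^\dagger-\frac12\, C_n^-\\ &\quad+\frac{(a_0-a_1)h}{2}\,X^{\otimes n}C_n^-+\frac{(a_0+a_1)h}{2}\,X^{\otimes n}C_n^-\,(I^{\otimes n-1}\otimes Z)+\frac12\, X^{\otimes n}C_n^-\,(I^{\otimes n-1}\otimes X), \end{align*} and each of the ten matrices $R_{3,1},\dots,R_{3,10}$ on the right-hand side is unitary, so that $A_{n,3}=\sum_{l=1}^{10}c_{3,l}R_{3,l}$ with real (possibly vanishing) coefficients $c_{3,l}$. Moreover, there is an absolute constant $K$ such that for all $n\ge1$ and $1\le l\le10$ the matrix $R_{3,l}$ can be implemented with a single ancilla qubit by a circuit on $n+1$ qubits, i.e. a circuit that maps $|\psi\rangle\otimes|0\rangle$ to $(R_{3,l}|\psi\rangle)\otimes|0\rangle$ for every $\psi\in\mathbb{C}^{2^n}$,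 that consists of at most one $Z$ gate, at most two Hadamard gates, and at most $Kn$ gates in total of the types Toffoli, $X$ and $CNOT$. -/

import Mathlib

/-! Matrices of size `2^n`, the tensor structure on `n` qubits, and quantum circuits. -/

namespace NRPoisson

noncomputable section

/-- The mesh width `h₃ = 1 / (2^n - 1)` of the grid `0 = x_0 < ⋯ < x_{2^n - 1} = 1`. -/
def meshWidth (n : ℕ) : ℝ := 1 / ((2 : ℝ) ^ n - 1)

/-- The second-order ghost-point discretization `L_{n,3}` of the second derivative on `(0,1)` with
boundary conditions `u_x(0) + a₀ u(0) = b₀` and `u_x(1) + a₁ u(1) = b₁`. -/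
def neumannRobinLaplacian (n : ℕ) (a₀ a₁ : ℝ) : Matrix (Fin (2 ^ n)) (Fin (2 ^ n)) ℝ :=
  (1 / meshWidth n ^ 2) • Matrix.of fun (i j : Fin (2 ^ n)) =>
    if i = j then
      if (i : ℕ) = 0 then -2 + 2 * a₀ * meshWidth n
      else if (i : ℕ) + 1 = 2 ^ n then -2 - 2 * a₁ * meshWidth n
      else -2
    else if (j : ℕ) = i + 1 then (if (i : ℕ) = 0 then 2 else 1)
    else if (i : ℕ) = j + 1 then (if (i : ℕ) + 1 = 2 ^ n then 2 else 1)
    else 0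

/-- The normalized matrix `A_{n,3} = h₃² L_{n,3}`. -/
def neumannRobinMatrix (n : ℕ) (a₀ a₁ : ℝ) : Matrix (Fin (2 ^ n)) (Fin (2 ^ n)) ℝ :=
  meshWidth n ^ 2 • neumannRobinLaplacian n a₀ a₁

/-- The increment gate `S_n : |j⟩ ↦ |j + 1 mod 2^n⟩`. -/
def increment (n : ℕ) : Matrix (Fin (2 ^ n)) (Fin (2 ^ n)) ℂ :=
  Matrix.of fun i j => if (i : ℕ) = ((j : ℕ) + 1) % 2 ^ n then 1 else 0

/-- The antidiagonal matrix `C_n⁻` with antidiagonal `(1, -1, …, -1, 1)`. -/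
def antidiagSign (n : ℕ) : Matrix (Fin (2 ^ n)) (Fin (2 ^ n)) ℂ :=
  Matrix.of fun (i j : Fin (2 ^ n)) =>
    if (i : ℕ) + j + 1 = 2 ^ n then (if (i : ℕ) = 0 ∨ (j : ℕ) = 0 then 1 else -1) else 0

/-- Computational basis labels of a `k`-qubit register; qubit `0` is the leftmost tensor factor. -/
abbrev Bits (k : ℕ) : Type := Fin k → Fin 2

/-- The identification of `{0, …, 2^k - 1}` with bit strings of length `k`,
qubit `0` being the most significant bit. -/
def toBits (k : ℕ) : Fin (2 ^ k) ≃ Bits k :=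
  finFunctionFinEquiv.symm.trans (Equiv.arrowCongr Fin.revPerm (Equiv.refl (Fin 2)))

/-- The tensor product `M 0 ⊗ M 1 ⊗ ⋯ ⊗ M (k-1)` of `2 × 2` matrices. -/
def tensor {k : ℕ} (M : Fin k → Matrix (Fin 2) (Fin 2) ℂ) : Matrix (Bits k) (Bits k) ℂ :=
  Matrix.of fun x y => ∏ i, M i (x i) (y i)

/-- The same tensor product as a matrix of size `2^k`, in the usual (Kronecker) order. -/
def kron {k : ℕ} (M : Fin k → Matrix (Fin 2) (Fin 2) ℂ) :
    Matrix (Fin (2 ^ k)) (Fin (2 ^ k)) ℂ :=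
  (tensor M).submatrix (toBits k) (toBits k)

/-- The Pauli `X` gate. -/
def pauliX : Matrix (Fin 2) (Fin 2) ℂ := !![0, 1; 1, 0]

/-- The Pauli `Z` gate. -/
def pauliZ : Matrix (Fin 2) (Fin 2) ℂ := !![1, 0; 0, -1]

/-- The Hadamard gate. -/
def hadamard : Matrix (Fin 2) (Fin 2) ℂ := ((1 / Real.sqrt 2 : ℝ) : ℂ) • !![1, 1; 1, -1]

/-- `X^{⊗ n}`. -/
def xAll (n : ℕ) : Matrix (Fin (2 ^ n)) (Fin (2 ^ n)) ℂ := kron fun _ : Fin n => pauliX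

/-- `I^{⊗ (n-1)} ⊗ G`: the single-qubit matrix `G` acting on the last of `n` qubits. -/
def onLast (n : ℕ) (G : Matrix (Fin 2) (Fin 2) ℂ) : Matrix (Fin (2 ^ n)) (Fin (2 ^ n)) ℂ :=
  kron fun i : Fin n => if (i : ℕ) + 1 = n then G else 1

/-- The ten unitaries of the decomposition of `A_{n,3}`. -/
def lcuTerm (n : ℕ) : Fin 10 → Matrix (Fin (2 ^ n)) (Fin (2 ^ n)) ℂ :=
  ![1,
    onLast n pauliX,
    xAll n,
    onLast n pauliZ,
    increment n,
    (increment n).conjTranspose,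
    antidiagSign n,
    xAll n * antidiagSign n,
    xAll n * antidiagSign n * onLast n pauliZ,
    xAll n * antidiagSign n * onLast n pauliX]

/-- The ten real coefficients of the decomposition of `A_{n,3}`. -/
def lcuCoeff (n : ℕ) (a₀ a₁ : ℝ) : Fin 10 → ℝ :=
  ![(-4 + (a₀ - a₁) * meshWidth n) / 2,
    1 / 2,
    -1 / 2,
    (a₀ + a₁) * meshWidth n / 2,
    1,
    1,
    -1 / 2,
    (a₀ - a₁) * meshWidth n / 2,
    (a₀ + a₁) * meshWidth n / 2,
    1 / 2]

/-- The elementary gates on a `k`-qubit register: `Z`, Hadamard and `X` on a target qubit `t`,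
`CNOT` with control `c`, and Toffoli with two distinct controls. -/
inductive Gate (k : ℕ) : Type
  | z (t : Fin k) : Gate k
  | had (t : Fin k) : Gate k
  | x (t : Fin k) : Gate k
  | cnot (c t : Fin k) (hct : c ≠ t) : Gate k
  | toffoli (c c' t : Fin k) (hcc : c ≠ c') (hct : c ≠ t) (hct' : c' ≠ t) : Gate k

/-- The single-qubit matrix `G` acting on qubit `t` of a `k`-qubit register. -/
def onQubit {k : ℕ} (t : Fin k) (G : Matrix (Fin 2) (Fin 2) ℂ) : Matrix (Bits k) (Bits k) ℂ :=
  tensor (Function.update (fun _ => 1) t G)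

/-- The multi-controlled `NOT` with controls `C` and target `t`: the basis vector `|x⟩` is mapped to
`|x⟩` with bit `t` flipped if all bits in `C` equal `1`, and to itself otherwise. -/
def controlledNot {k : ℕ} (C : Finset (Fin k)) (t : Fin k) : Matrix (Bits k) (Bits k) ℂ :=
  Matrix.of fun y x =>
    if y = (if ∀ c ∈ C, x c = 1 then Function.update x t (x t + 1) else x) then 1 else 0

/-- The matrix of a gate. -/
def Gate.matrix {k : ℕ} : Gate k → Matrix (Bits k) (Bits k) ℂ
  | .z t => onQubit t pauliZ
  | .had t => onQubit t hadamard
  | .x t => onQubit t pauliX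
  | .cnot c t _ => controlledNot {c} t
  | .toffoli c c' t _ _ _ => controlledNot {c, c'} t

/-- Recognizes `Z` gates. -/
def Gate.isZ {k : ℕ} : Gate k → Bool
  | .z _ => true
  | _ => false

/-- Recognizes Hadamard gates. -/
def Gate.isHadamard {k : ℕ} : Gate k → Bool
  | .had _ => true
  | _ => false

/-- Recognizes `X`, `CNOT` and Toffoli gates. -/
def Gate.isClassical {k : ℕ} : Gate k → Bool
  | .x _ => true
  | .cnot _ _ _ => true
  | .toffoli _ _ _ _ _ _ => true
  | _ => false

/-- A circuit on `k` qubits: a list of gates, the head of the list being applied first. -/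
abbrev Circuit (k : ℕ) : Type := List (Gate k)

/-- The matrix of a circuit. -/
def Circuit.matrix {k : ℕ} : Circuit k → Matrix (Bits k) (Bits k) ℂ
  | [] => 1
  | g :: C => Circuit.matrix C * g.matrix

/-- The state `|ψ⟩ ⊗ |0⟩` of `n` data qubits and one ancilla qubit (the last one). -/
def withAncilla {n : ℕ} (ψ : Fin (2 ^ n) → ℂ) : Bits (n + 1) → ℂ :=
  fun z => if z (Fin.last n) = 0 then ψ ((toBits n).symm (Fin.init z)) else 0

/-- The circuit `C` on `n` data qubits and one ancilla implements the `n`-qubit operator `R`: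
it maps `|ψ⟩ ⊗ |0⟩` to `(R |ψ⟩) ⊗ |0⟩` for all `ψ`. -/
def Implements {n : ℕ} (C : Circuit (n + 1)) (R : Matrix (Fin (2 ^ n)) (Fin (2 ^ n)) ℂ) : Prop :=
  ∀ ψ : Fin (2 ^ n) → ℂ,
    (Circuit.matrix C).mulVec (withAncilla ψ) = withAncilla (R.mulVec ψ)

end

end NRPoisson

/-!
The decomposition is checked entry by entry. The product of `X^{⊗ n}` and `C_n⁻` is the diagonal
matrix `D` with diagonal `(1, -1, …, -1, 1)`, so that `(1 + D) / 2` projects onto the first and the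
last basis vector; multiplied with `1`, with `Z` or with `X` on the last qubit it supplies the
modified entries of the two boundary rows. The antidiagonal terms `X^{⊗ n} + C_n⁻` remove the
wrap-around entries of `S_n + S_n†`.

For the circuits, `X`, `CNOT` and Toffoli gates are permutations of the computational basis, and
everything reduces to two linear-size reversible circuits.

* Multi-controlled `NOT` gates (`classicalCost_ctrlNot`): if as many wires can be borrowed as there
  are controls, a palindromic Toffoli ladder, run twice, does it
  (`classicalCost_ctrlNot_of_borrowed`); if a single wire can be borrowed, the controls are split
  into halves that lend wires to each other.
* The increment with one clean ancilla (`exists_increment`): the register is split into halves of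
  equal length. The carry out of the lower half is computed into the ancilla, and a carry is added
  to one half by adding the other half together with the carry and subtracting the other half
  without it. The adder is a ripple-carry adder (`exists_adder`) which keeps the carries on the
  wires of the summand and therefore needs no work space besides the ancilla.

The operator `D` is obtained by phase kickback from the ancilla prepared in the state
`(|0⟩ - |1⟩) / √2`, which takes two Hadamard gates and no `Z` gate (`implementable_diagonal`). The
condition to be kicked back is that the data bits are not all equal; adding the last bit to the
others makes it a condition on the others alone, so that the last data wire can be borrowed.
-/

namespace NRPoisson

open Equiv Function

/-! ### Multi-controlled `NOT` gates -/

/-- The conjunction, as a bit, of the bits of `s` on the wires in `C`. -/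
def conj {k : ℕ} (C : Finset (Fin k)) (s : Bits k) : Fin 2 := if ∀ c ∈ C, s c = 1 then 1 else 0

theorem bit_add_add_cancel (a b : Fin 2) : a + b + b = a := by revert a b; decide

@[simp] theorem conj_empty {k : ℕ} (s : Bits k) : conj ∅ s = 1 := by simp [conj]

theorem conj_insert {k : ℕ} (c : Fin k) (C : Finset (Fin k)) (s : Bits k) :
    conj (insert c C) s = s c * conj C s := by
  have h : ∀ a : Fin 2, a = 0 ∨ a = 1 := by decide
  rcases h (s c) with h | h <;> simp [conj, h]

@[simp] theorem conj_singleton {k : ℕ} (c : Fin k) (s : Bits k) : conj {c} s = s c := by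
  have := conj_insert c ∅ s
  simpa using this

theorem conj_union {k : ℕ} (A B : Finset (Fin k)) (s : Bits k) :
    conj (A ∪ B) s = conj A s * conj B s := by
  induction A using Finset.induction_on with
  | empty => simp
  | insert c A _ ih => rw [Finset.insert_union, conj_insert, conj_insert, ih, mul_assoc]

theorem conj_congr {k : ℕ} {C : Finset (Fin k)} {s s' : Bits k} (h : ∀ c ∈ C, s c = s' c) :
    conj C s = conj C s' := by
  unfold conj
  congr 1
  exact propext (forall₂_congr fun c hc => by rw [h c hc])

theorem conj_update {k : ℕ} {C : Finset (Fin k)} {t : Fin k} (h : t ∉ C) (s : Bits k) (v : Fin 2) :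
    conj C (update s t v) = conj C s :=
  conj_congr fun c hc => update_of_ne (by rintro rfl; exact h hc) _ _

/-- The multi-controlled `NOT` with controls `C` and target `t`, as a permutation of the
computational basis. -/
def ctrlNot {k : ℕ} (C : Finset (Fin k)) (t : Fin k) (h : t ∉ C) : Perm (Bits k) :=
  Involutive.toPerm (fun s => update s t (s t + conj C s)) fun s => by
    simp [conj_update h, bit_add_add_cancel]

theorem ctrlNot_apply {k : ℕ} {C : Finset (Fin k)} {t : Fin k} (h : t ∉ C) (s : Bits k) :
    ctrlNot C t h s = update s t (s t + conj C s) := rfl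

theorem ctrlNot_apply_target {k : ℕ} {C : Finset (Fin k)} {t : Fin k} (h : t ∉ C) (s : Bits k) :
    ctrlNot C t h s t = s t + conj C s := by simp [ctrlNot_apply]

theorem ctrlNot_apply_of_ne {k : ℕ} {C : Finset (Fin k)} {t w : Fin k} (h : t ∉ C) (hw : w ≠ t)
    (s : Bits k) : ctrlNot C t h s w = s w := by simp [ctrlNot_apply, hw]

theorem ctrlNot_mul_self {k : ℕ} {C : Finset (Fin k)} {t : Fin k} (h : t ∉ C) :
    ctrlNot C t h * ctrlNot C t h = 1 := by
  ext1 s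
  simp [ctrlNot_apply, conj_update h, bit_add_add_cancel]

theorem ctrlNot_inv {k : ℕ} {C : Finset (Fin k)} {t : Fin k} (h : t ∉ C) :
    (ctrlNot C t h)⁻¹ = ctrlNot C t h := inv_eq_of_mul_eq_one_left (ctrlNot_mul_self h)

theorem ctrlNot_update {k : ℕ} {C : Finset (Fin k)} {t w : Fin k} (h : t ∉ C) (hw : w ≠ t)
    (hC : w ∉ C) (s : Bits k) (v : Fin 2) :
    ctrlNot C t h (update s w v) = update (ctrlNot C t h s) w v := by
  rw [ctrlNot_apply, ctrlNot_apply, conj_update hC, update_of_ne hw.symm, update_comm hw.symm]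

/-- The permutation `e` of the computational basis is a product of at most `N` of the gates
`X`, `CNOT` and Toffoli. -/
def ClassicalCost {k : ℕ} (N : ℕ) (e : Perm (Bits k)) : Prop :=
  ∃ L : List (Perm (Bits k)), L.length ≤ N ∧ L.prod = e ∧
    ∀ f ∈ L, ∃ (C : Finset (Fin k)) (t : Fin k) (h : t ∉ C), C.card ≤ 2 ∧ f = ctrlNot C t h

namespace ClassicalCost

variable {k N N' : ℕ} {e e' : Perm (Bits k)}

theorem one : ClassicalCost N (1 : Perm (Bits k)) := ⟨[], by simp, rfl, by simp⟩

theorem mono (h : ClassicalCost N e) (hN : N ≤ N') : ClassicalCost N' e := by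
  obtain ⟨L, h1, h2⟩ := h
  exact ⟨L, h1.trans hN, h2⟩

theorem mul (h : ClassicalCost N e) (h' : ClassicalCost N' e') :
    ClassicalCost (N + N') (e * e') := by
  obtain ⟨L, h1, rfl, h3⟩ := h
  obtain ⟨L', h1', rfl, h3'⟩ := h'
  refine ⟨L ++ L', by simp; omega, by simp, fun f hf => ?_⟩
  rcases List.mem_append.1 hf with hf | hf
  exacts [h3 f hf, h3' f hf]

theorem inv (h : ClassicalCost N e) : ClassicalCost N e⁻¹ := by
  obtain ⟨L, h1, rfl, h3⟩ := h
  refine ⟨(L.map (·⁻¹)).reverse, by simpa using h1, (List.prod_inv_reverse L).symm, fun f hf => ?_⟩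
  simp only [List.mem_reverse, List.mem_map] at hf
  obtain ⟨g, hg, rfl⟩ := hf
  obtain ⟨C, t, h, hC, rfl⟩ := h3 g hg
  exact ⟨C, t, h, hC, ctrlNot_inv h⟩

theorem ctrlNot {C : Finset (Fin k)} {t : Fin k} (h : t ∉ C) (hC : C.card ≤ 2) :
    ClassicalCost 1 (ctrlNot C t h) :=
  ⟨[NRPoisson.ctrlNot C t h], by simp, by simp, fun f hf => ⟨C, t, h, hC, by simpa using hf⟩⟩

end ClassicalCost

/-- A palindromic Toffoli ladder along the borrowed wires `gs` which adds the conjunction of the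
controls `cs` to the target `t`. It is an involution; it also changes the borrowed wires, which
is repaired in `classicalCost_ctrlNot_of_borrowed`. -/
theorem exists_ladder {k : ℕ} (gs : List (Fin k)) : ∀ (cs : List (Fin k)) (t : Fin k),
    (t :: (cs ++ gs)).Nodup → cs.length ≤ gs.length + 2 →
    ∃ V : Perm (Bits k), ClassicalCost (2 * cs.length + 1) V ∧ V * V = 1 ∧
      (∀ s, V s t = s t + conj cs.toFinset s) ∧
      (∀ s w, w ≠ t → w ∉ gs → V s w = s w) ∧
      (∀ s w v, w ≠ t → w ∉ cs → w ∉ gs → V (update s w v) = update (V s) w v) := by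
  have base : ∀ (gs cs : List (Fin k)) (t : Fin k), t ∉ cs → cs.length ≤ 2 →
    ∃ V : Perm (Bits k), ClassicalCost (2 * cs.length + 1) V ∧ V * V = 1 ∧
      (∀ s, V s t = s t + conj cs.toFinset s) ∧
      (∀ s w, w ≠ t → w ∉ gs → V s w = s w) ∧
      (∀ s w v, w ≠ t → w ∉ cs → w ∉ gs → V (update s w v) = update (V s) w v) := by
    intro gs cs t ht hl
    have ht' : t ∉ cs.toFinset := by simpa using ht
    refine ⟨ctrlNot cs.toFinset t ht', (ClassicalCost.ctrlNot _ ?_).mono (by omega),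
      ctrlNot_mul_self _, ctrlNot_apply_target _, fun s w hw _ => ctrlNot_apply_of_ne _ hw s,
      fun s w v hw hc _ => ctrlNot_update _ hw (by simpa using hc) s v⟩
    exact (List.toFinset_card_le cs).trans (by omega)
  induction gs with
  | nil =>
    intro cs t hn hl
    exact base [] cs t (by simp at hn; exact hn.1) (by simpa using hl)
  | cons g gs ih =>
    rintro (_ | ⟨c, cs⟩) t hn hl
    · exact base _ [] t (by simp) (by simp)
    have hn' : (g :: (cs ++ gs)).Nodup ∧ t ≠ g ∧ t ≠ c ∧ c ≠ g ∧ t ∉ cs ∧ t ∉ gs ∧ c ∉ gs ∧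
        c ∉ cs := by
      simp only [List.cons_append, List.nodup_cons, List.mem_cons, List.mem_append,
        List.nodup_append] at hn ⊢
      grind
    obtain ⟨hn1, htg, htc, hcg, htcs, htgs, hcgs, hccs⟩ := hn'
    obtain ⟨V, hV, hVV, hVt, hVf, hVu⟩ := ih cs g hn1 (by simpa using hl)
    have hT : t ∉ ({c, g} : Finset (Fin k)) := by simp [htc, htg]
    have hcT : ∀ s, conj {c, g} s = s c * s g := fun s => by rw [conj_insert]; simp
    refine ⟨ctrlNot {c, g} t hT * V * ctrlNot {c, g} t hT,
      (((ClassicalCost.ctrlNot hT Finset.card_le_two).mul hV).mul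
        (ClassicalCost.ctrlNot hT Finset.card_le_two)).mono
        (by simp only [List.length_cons]; omega), ?_, ?_, ?_, ?_⟩
    · have := ctrlNot_mul_self hT
      calc _ = ctrlNot {c, g} t hT * V * (ctrlNot {c, g} t hT * ctrlNot {c, g} t hT) * V
            * ctrlNot {c, g} t hT := by group
        _ = ctrlNot {c, g} t hT * (V * V) * ctrlNot {c, g} t hT := by rw [this]; group
        _ = 1 := by rw [hVV, mul_one, this]
    · intro s
      rw [Perm.mul_apply, Perm.mul_apply, ctrlNot_apply_target, hcT, hVf _ t htg htgs,
        hVf _ c hcg hcgs, hVt, ctrlNot_apply_target, ctrlNot_apply_of_ne hT htc.symm,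
        ctrlNot_apply_of_ne hT htg.symm, hcT, ctrlNot_apply, conj_update (by simpa using htcs),
        List.toFinset_cons, conj_insert]
      generalize s t = x; generalize s c = y; generalize s g = z
      generalize conj cs.toFinset s = u
      revert x y z u; decide
    · intro s w hw hg
      simp only [List.mem_cons, not_or] at hg
      rw [Perm.mul_apply, Perm.mul_apply, ctrlNot_apply_of_ne hT hw, hVf _ w hg.1 hg.2,
        ctrlNot_apply_of_ne hT hw]
    · intro s w v hw hc hg
      simp only [List.mem_cons, not_or] at hg hc
      have hwT : w ∉ ({c, g} : Finset (Fin k)) := by simp [hc.1, hg.1]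
      simp only [Perm.mul_apply]
      rw [ctrlNot_update hT hw hwT, hVu _ _ _ hg.1 hc.2 hg.2, ctrlNot_update hT hw hwT]

/-- A multi-controlled `NOT` has linear cost if almost as many wires as there are controls can be
borrowed: running the inner part of the ladder once more restores the borrowed wires. -/
theorem classicalCost_ctrlNot_of_borrowed {k : ℕ} {C G : Finset (Fin k)} {t : Fin k} (ht : t ∉ C)
    (htG : t ∉ G) (hCG : Disjoint C G) (hc : C.card ≤ G.card + 2) :
    ClassicalCost (4 * C.card + 1) (ctrlNot C t ht) := by
  rcases le_or_gt C.card 2 with h2 | h2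
  · exact (ClassicalCost.ctrlNot ht h2).mono (by omega)
  obtain ⟨c, hcC⟩ : C.Nonempty := Finset.card_pos.1 (by omega)
  obtain ⟨g, hgG⟩ : G.Nonempty := Finset.card_pos.1 (by omega)
  have hgC : g ∉ C := Finset.disjoint_right.1 hCG hgG
  have hcG : c ∉ G := Finset.disjoint_left.1 hCG hcC
  have htg : t ≠ g := by rintro rfl; exact htG hgG
  have htc : t ≠ c := by rintro rfl; exact ht hcC
  have hcg : c ≠ g := by rintro rfl; exact hgC hcC
  obtain ⟨V, hV, hVV, hVt, hVf, hVu⟩ := exists_ladder (G.erase g).toList (C.erase c).toList g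
    (by
      simp only [List.nodup_cons, List.nodup_append, Finset.nodup_toList, List.mem_append,
        Finset.mem_toList, Finset.mem_erase, true_and]
      refine ⟨by simp [hgC], ?_⟩
      rintro a ⟨-, ha⟩ b ⟨-, hb⟩ rfl
      exact Finset.disjoint_left.1 hCG ha hb)
    (by
      rw [Finset.length_toList, Finset.length_toList, Finset.card_erase_of_mem hcC,
        Finset.card_erase_of_mem hgG]
      omega)
  simp only [Finset.toList_toFinset, Finset.mem_toList, Finset.length_toList] at hV hVt hVf hVu
  have hT : t ∉ ({c, g} : Finset (Fin k)) := by simp [htc, htg]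
  have hcT : ∀ s, conj {c, g} s = s c * s g := fun s => by rw [conj_insert]; simp
  have hVV' : ∀ s, V (V s) = s := fun s => by rw [← Perm.mul_apply, hVV]; rfl
  have key : ctrlNot C t ht = ctrlNot {c, g} t hT * V * ctrlNot {c, g} t hT * V := by
    ext1 s
    have hC : conj C s = s c * conj (C.erase c) s := by
      rw [← conj_insert, Finset.insert_erase hcC]
    have e1 : (V s) t = s t := hVf s t htg (by simp [htG])
    have e2 : (V s) c = s c := hVf s c hcg (by simp [hcG])
    simp only [Perm.mul_apply]
    rw [ctrlNot_apply hT (V s), hVu _ t _ htg (by simp [ht]) (by simp [htG]), hVV',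
      ctrlNot_apply hT, ctrlNot_apply, hcT, hcT, e1, e2, hVt, hC, update_idem, update_self,
      update_of_ne htc.symm, update_of_ne htg.symm]
    congr 1
    generalize s t = x; generalize s c = y; generalize s g = z
    generalize conj (C.erase c) s = u
    revert x y z u; decide
  rw [key]
  have hT1 := ClassicalCost.ctrlNot hT Finset.card_le_two
  refine (((hT1.mul hV).mul hT1).mul hV).mono ?_
  rw [Finset.card_erase_of_mem hcC]
  omega

/-- A multi-controlled `NOT` has linear cost if a single wire can be borrowed: the controls are
split into halves, the conjunction of the first half is put on the borrowed wire `d`, and each half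
serves as the supply of borrowed wires for the other. -/
theorem classicalCost_ctrlNot {k : ℕ} {C : Finset (Fin k)} {t d : Fin k} (ht : t ∉ C)
    (hd : d ∉ C) (hdt : d ≠ t) : ClassicalCost (8 * C.card + 12) (ctrlNot C t ht) := by
  obtain ⟨B, hBC, hB⟩ := Finset.exists_subset_card_eq (show C.card / 2 ≤ C.card by omega)
  have hA : (C \ B).card = C.card - C.card / 2 := by rw [Finset.card_sdiff_of_subset hBC, hB]
  set A := C \ B with hAdef
  have hAB : A ∪ B = C := Finset.sdiff_union_of_subset hBC
  have hdisj : Disjoint A B := Finset.sdiff_disjoint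
  have hAC : A ⊆ C := Finset.sdiff_subset
  have hdA : d ∉ A := fun h => hd (hAC h)
  have hdB : d ∉ B := fun h => hd (hBC h)
  have htA : t ∉ A := fun h => ht (hAC h)
  have htB : t ∉ B := fun h => ht (hBC h)
  have htB' : t ∉ insert d B := by simp [htB, hdt.symm]
  have h1 : ClassicalCost (4 * A.card + 1) (ctrlNot A d hdA) :=
    classicalCost_ctrlNot_of_borrowed hdA hdB hdisj (by omega)
  have h2 : ClassicalCost (4 * (insert d B).card + 1) (ctrlNot (insert d B) t htB') :=
    classicalCost_ctrlNot_of_borrowed htB' htA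
      (by rw [Finset.disjoint_insert_left]; exact ⟨hdA, hdisj.symm⟩)
      (by rw [Finset.card_insert_of_notMem hdB]; omega)
  rw [Finset.card_insert_of_notMem hdB] at h2
  have key : ctrlNot C t ht = ctrlNot (insert d B) t htB' * ctrlNot A d hdA *
      ctrlNot (insert d B) t htB' * ctrlNot A d hdA := by
    ext1 s
    have hC : conj C s = conj A s * conj B s := by rw [← conj_union, hAB]
    simp only [Perm.mul_apply, ctrlNot_apply, conj_insert, conj_update hdA, conj_update htA,
      conj_update hdB, conj_update htB, update_self, update_of_ne hdt.symm,
      update_comm hdt, update_idem, bit_add_add_cancel, hC]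
    rw [update_comm hdt.symm, update_eq_self]
    congr 1
    generalize s t = x; generalize s d = y; generalize conj A s = z
    generalize conj B s = u
    revert x y z u; decide
  rw [key]
  exact (((h2.mul h1).mul h2).mul h1).mono (by omega)

/-! ### Reversible arithmetic -/

/-- The number stored on the wires of a list, the head of the list being the least significant
bit. -/
def regVal {k : ℕ} : List (Fin k) → Bits k → ℕ
  | [], _ => 0
  | w :: ws, s => (s w : ℕ) + 2 * regVal ws s

theorem regVal_congr {k : ℕ} {ws : List (Fin k)} {s s' : Bits k} (h : ∀ w ∈ ws, s w = s' w) :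
    regVal ws s = regVal ws s' := by
  induction ws with
  | nil => rfl
  | cons w ws ih =>
    rw [regVal, regVal, h w (by simp), ih fun v hv => h v (by simp [hv])]

theorem regVal_append {k : ℕ} (us ws : List (Fin k)) (s : Bits k) :
    regVal (us ++ ws) s = regVal us s + 2 ^ us.length * regVal ws s := by
  induction us with
  | nil => simp [regVal]
  | cons u us ih => rw [List.cons_append, regVal, regVal, ih, List.length_cons, pow_succ]; ring

theorem regVal_lt {k : ℕ} (ws : List (Fin k)) (s : Bits k) : regVal ws s < 2 ^ ws.length := by
  induction ws with
  | nil => simp [regVal]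
  | cons w ws ih => rw [regVal, List.length_cons, pow_succ]; omega

/-- The conjunction of the bits of a register is the carry out of its increment. -/
theorem conj_eq_carry {k : ℕ} (ws : List (Fin k)) (s : Bits k) :
    ((conj ws.toFinset s : Fin 2) : ℕ) = (regVal ws s + 1) / 2 ^ ws.length := by
  induction ws with
  | nil => simp [regVal]
  | cons w ws ih =>
    have h2 : ∀ a b : Fin 2, ((a * b : Fin 2) : ℕ) = a * b := by decide
    have hb : ∀ a : Fin 2, (a : ℕ) = 0 ∨ (a : ℕ) = 1 := by decide
    rw [List.toFinset_cons, conj_insert, h2, ih, regVal, List.length_cons, pow_succ',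
      ← Nat.div_div_eq_div_mul]
    rcases hb (s w) with h | h <;> rw [h]
    · rw [show (0 + 2 * regVal ws s + 1) / 2 = regVal ws s by omega, zero_mul,
        Nat.div_eq_of_lt (regVal_lt ws s)]
    · rw [show (1 + 2 * regVal ws s + 1) / 2 = regVal ws s + 1 by omega, one_mul]

/-- A ripple-carry adder without further work space: `bs` is replaced by `bs + as + c`, where the
carry wire `c` and the register `as` are restored. Each carry is kept on the wire of the preceding
summand bit while the higher bits are processed. -/
theorem exists_adder {k : ℕ} (as : List (Fin k)) : ∀ (bs : List (Fin k)) (c : Fin k),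
    as.length = bs.length → (c :: (as ++ bs)).Nodup →
    ∃ e : Perm (Bits k), ClassicalCost (6 * as.length) e ∧
      (∀ s w, w ∉ bs → e s w = s w) ∧
      ∀ s, (regVal bs (e s) : ℤ) ≡ regVal as s + regVal bs s + (s c : ℕ)
        [ZMOD 2 ^ bs.length] := by
  induction as with
  | nil =>
    rintro (_ | _) c hl hn
    · exact ⟨1, ClassicalCost.one, by simp, fun s => by simp [Int.modEq_one]⟩
    · simp at hl
  | cons a as ih =>
    rintro (_ | ⟨b, bs⟩) c hl hn
    · simp at hl
    have hn' : (a :: (as ++ bs)).Nodup ∧ a ≠ c ∧ a ≠ b ∧ b ≠ c ∧ c ∉ as ∧ c ∉ bs ∧ b ∉ as ∧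
        b ∉ bs ∧ a ∉ as ∧ a ∉ bs := by
      simp only [List.cons_append, List.nodup_cons, List.mem_cons, List.mem_append,
        List.nodup_append] at hn ⊢
      grind
    obtain ⟨hn1, hac, hab, hbc, hcas, hcbs, hbas, hbbs, haas, habs⟩ := hn'
    obtain ⟨e, he, hef, hev⟩ := ih bs a (by simpa using hl) hn1
    have h1 : b ∉ ({a} : Finset (Fin k)) := by simp [hab.symm]
    have h2 : c ∉ ({a} : Finset (Fin k)) := by simp [hac.symm]
    have h3 : a ∉ ({b, c} : Finset (Fin k)) := by simp [hab, hac]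
    have h4 : b ∉ ({c} : Finset (Fin k)) := by simp [hbc]
    -- `M` puts the majority of the three bits, that is the carry, on `a`; `U` undoes this and
    -- leaves the sum bit on `b`.
    set M := ctrlNot {b, c} a h3 * ctrlNot {a} c h2 * ctrlNot {a} b h1 with hM
    set U := ctrlNot {c} b h4 * ctrlNot {a} c h2 * ctrlNot {b, c} a h3 with hU
    have hMe : ∀ s, M s b = s b + s a ∧ M s c = s c + s a ∧
        M s a = s a + (s b + s a) * (s c + s a) ∧ ∀ w, w ≠ a → w ≠ b → w ≠ c → M s w = s w := by
      intro s
      refine ⟨?_, ?_, ?_, fun w h h' h'' => ?_⟩ <;>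
        simp [ctrlNot_apply, conj_insert, hab.symm, hbc.symm, hac.symm, *]
    have hUe : ∀ s, U s a = s a + s b * s c ∧ U s c = s c + (s a + s b * s c) ∧
        U s b = s b + (s c + (s a + s b * s c)) ∧
        ∀ w, w ≠ a → w ≠ b → w ≠ c → U s w = s w := by
      intro s
      refine ⟨?_, ?_, ?_, fun w h h' h'' => ?_⟩ <;>
        simp [ctrlNot_apply, conj_insert, hab.symm, hbc.symm, hac.symm, *]
    have hcM : ClassicalCost 3 M :=
      ((ClassicalCost.ctrlNot h3 Finset.card_le_two).mul (ClassicalCost.ctrlNot h2 (by simp))).mul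
        (ClassicalCost.ctrlNot h1 (by simp))
    have hcU : ClassicalCost 3 U :=
      ((ClassicalCost.ctrlNot h4 (by simp)).mul (ClassicalCost.ctrlNot h2 (by simp))).mul
        (ClassicalCost.ctrlNot h3 Finset.card_le_two)
    refine ⟨U * e * M, ((hcU.mul he).mul hcM).mono (by simp only [List.length_cons]; omega),
      fun s w hw => ?_, fun s => ?_⟩
    · simp only [List.mem_cons, not_or] at hw
      obtain ⟨m1, m2, m3, m4⟩ := hMe s
      obtain ⟨u1, u2, u3, u4⟩ := hUe (e (M s))
      simp only [Perm.mul_apply]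
      by_cases hwa : w = a
      · rw [hwa, u1, hef _ a habs, hef _ b hbbs, hef _ c hcbs, m1, m2, m3]
        generalize s a = x; generalize s b = y; generalize s c = z
        revert x y z; decide
      by_cases hwc : w = c
      · rw [hwc, u2, hef _ a habs, hef _ b hbbs, hef _ c hcbs, m1, m2, m3]
        generalize s a = x; generalize s b = y; generalize s c = z
        revert x y z; decide
      rw [u4 w hwa hw.1 hwc, hef _ w hw.2, m4 w hwa hw.1 hwc]
    · obtain ⟨m1, m2, m3, m4⟩ := hMe s
      obtain ⟨u1, u2, u3, u4⟩ := hUe (e (M s))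
      have hb : (U (e (M s)) b : Fin 2) = s a + s b + s c := by
        rw [u3, hef _ a habs, hef _ b hbbs, hef _ c hcbs, m1, m2, m3]
        generalize s a = x; generalize s b = y; generalize s c = z
        revert x y z; decide
      have hbs : regVal bs (U (e (M s))) = regVal bs (e (M s)) :=
        regVal_congr fun w hw => u4 w (fun h => habs (h ▸ hw)) (fun h => hbbs (h ▸ hw))
          (fun h => hcbs (h ▸ hw))
      have hbs' : regVal bs (M s) = regVal bs s :=
        regVal_congr fun w hw => m4 w (fun h => habs (h ▸ hw)) (fun h => hbbs (h ▸ hw))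
          (fun h => hcbs (h ▸ hw))
      have has' : regVal as (M s) = regVal as s :=
        regVal_congr fun w hw => m4 w (fun h => haas (h ▸ hw)) (fun h => hbas (h ▸ hw))
          (fun h => hcas (h ▸ hw))
      -- the full adder: sum bit plus twice the carry
      have hfull : ∀ x y z : Fin 2, ((x + y + z : Fin 2) : ℤ) +
          2 * ((x + (y + x) * (z + x) : Fin 2) : ℕ) = (x : ℕ) + (y : ℕ) + (z : ℕ) := by decide
      have hrec := hev (M s)
      rw [hbs', has', m3] at hrec
      simp only [Perm.mul_apply, regVal, hb, hbs, List.length_cons]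
      have hf := hfull (s a) (s b) (s c)
      have := (hrec.mul_left' (c := 2)).add_left ((s a + s b + s c : Fin 2) : ℤ)
      rw [pow_succ']
      push_cast at this hf ⊢
      refine this.trans (congrArg (· % _) ?_)
      linear_combination hf

/-- Carry arithmetic for an increment performed on the two parts of a register separately. -/
theorem regVal_append_modEq_succ {k : ℕ} {lo hi : List (Fin k)} {s s' : Bits k}
    (hlo : (regVal lo s' : ℤ) ≡ regVal lo s + 1 [ZMOD 2 ^ lo.length])
    (hhi : (regVal hi s' : ℤ) ≡ regVal hi s + (conj lo.toFinset s : ℕ) [ZMOD 2 ^ hi.length]) :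
    (regVal (lo ++ hi) s' : ℤ) ≡ regVal (lo ++ hi) s + 1 [ZMOD 2 ^ (lo ++ hi).length] := by
  have hlo' : (regVal lo s' : ℤ) + 2 ^ lo.length * (conj lo.toFinset s : ℕ) =
      regVal lo s + 1 := by
    have h1 : regVal lo s' ≡ regVal lo s + 1 [MOD 2 ^ lo.length] := by
      rw [← Int.natCast_modEq_iff]; exact_mod_cast hlo
    have h2 : regVal lo s' = (regVal lo s + 1) % 2 ^ lo.length := by
      rw [← h1, Nat.mod_eq_of_lt (regVal_lt _ _)]
    have h3 := Nat.mod_add_div (regVal lo s + 1) (2 ^ lo.length)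
    rw [← h2, ← conj_eq_carry] at h3
    exact_mod_cast h3
  have := (hhi.mul_left' (c := 2 ^ lo.length)).add_left (regVal lo s' : ℤ)
  rw [List.length_append, pow_add, regVal_append, regVal_append]
  push_cast at this ⊢
  refine this.trans (congrArg (· % _) ?_)
  linear_combination hlo'

/-- The increment of a register of even length with one clean work wire `g`: the carry out of the
lower half is put on `g` and added to the upper half, and then `1` is added to the lower half. Each
half is the borrowed register of the other: adding the half and a carry and then subtracting the
half without a carry adds just the carry. -/
theorem exists_increment_append {k : ℕ} {lo hi : List (Fin k)} {g : Fin k}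
    (hl : lo.length = hi.length) (hn : (g :: (lo ++ hi)).Nodup) :
    ∃ e : Perm (Bits k), ClassicalCost (32 * lo.length + 4) e ∧
      ∀ s, s g = 0 → (∀ w, w ∉ lo ++ hi → e s w = s w) ∧
        (regVal (lo ++ hi) (e s) : ℤ) ≡ regVal (lo ++ hi) s + 1 [ZMOD 2 ^ (lo ++ hi).length] := by
  have hn' : (g :: (hi ++ lo)).Nodup ∧ g ∉ lo ∧ g ∉ hi ∧ (∀ w ∈ lo, w ∉ hi) ∧ lo.Nodup ∧
      hi.Nodup := by
    simp only [List.nodup_cons, List.mem_append, List.nodup_append] at hn ⊢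
    grind
  obtain ⟨hn', hglo, hghi, hdisj, hnlo, hnhi⟩ := hn'
  obtain ⟨p, hp, hpf, hpv⟩ := exists_adder lo hi g hl hn
  obtain ⟨q, hq, hqf, hqv⟩ := exists_adder hi lo g hl.symm hn'
  have hF : g ∉ lo.toFinset := by simpa using hglo
  have hcF : ClassicalCost (4 * lo.length + 1) (ctrlNot lo.toFinset g hF) := by
    have := classicalCost_ctrlNot_of_borrowed (G := hi.toFinset) hF (by simpa using hghi)
      (by rw [Finset.disjoint_left]; simpa using hdisj)
      (by rw [List.toFinset_card_of_nodup hnlo, List.toFinset_card_of_nodup hnhi]; omega)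
    rwa [List.toFinset_card_of_nodup hnlo] at this
  have hX : g ∉ (∅ : Finset (Fin k)) := by simp
  have hcX := ClassicalCost.ctrlNot hX (by simp)
  refine ⟨(q⁻¹ * ctrlNot ∅ g hX * q * ctrlNot ∅ g hX) *
    (p⁻¹ * ctrlNot lo.toFinset g hF * p * ctrlNot lo.toFinset g hF), ?_, fun s hs => ?_⟩
  · exact ((((hq.inv.mul hcX).mul hq).mul hcX).mul
      (((hp.inv.mul hcF).mul hp).mul hcF)).mono (by omega)
  -- Both halves of the circuit replace `ys` by `ys + conj C`, with `xs` as borrowed register: `r`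
  -- adds `xs` and the carry stored on `g`, and `r⁻¹` subtracts `xs` once `g` is `0` again.
  have half : ∀ (xs ys : List (Fin k)) (r : Perm (Bits k)) (C : Finset (Fin k)) (hC : g ∉ C)
      (s : Bits k), g ∉ xs → g ∉ ys → (∀ w ∈ xs, w ∉ ys) → (∀ w ∈ C, w ∉ ys) → s g = 0 →
      (∀ s w, w ∉ ys → r s w = s w) →
      (∀ s, (regVal ys (r s) : ℤ) ≡ regVal xs s + regVal ys s + (s g : ℕ) [ZMOD 2 ^ ys.length]) →
      (∀ w, w ∉ ys → (r⁻¹ * ctrlNot C g hC * r * ctrlNot C g hC) s w = s w) ∧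
      (regVal ys ((r⁻¹ * ctrlNot C g hC * r * ctrlNot C g hC) s) : ℤ) ≡
        regVal ys s + (conj C s : ℕ) [ZMOD 2 ^ ys.length] := by
    intro xs ys r C hC s hgx hgy hxy hCy hs hrf hrv
    have hif : ∀ s w, w ∉ ys → r⁻¹ s w = s w := by
      intro s w hw
      have := hrf (r⁻¹ s) w hw
      rw [show r (r⁻¹ s) = s from r.apply_symm_apply s] at this
      exact this.symm
    have hf1 : ∀ s w, w ≠ g → ctrlNot C g hC s w = s w := fun s w hw =>
      ctrlNot_apply_of_ne hC hw s
    set s1 := ctrlNot C g hC s with hs1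
    set s2 := r s1 with hs2
    set s3 := ctrlNot C g hC s2 with hs3
    set s4 := r⁻¹ s3 with hs4
    have e4 : (r⁻¹ * ctrlNot C g hC * r * ctrlNot C g hC) s = s4 := by
      simp [Perm.mul_apply, hs4, hs3, hs2, hs1]
    have hcg : conj C s2 = conj C s := conj_congr fun w hw => by
      rw [hs2, hrf _ _ (hCy w hw), hs1, hf1 _ _ (fun h => hC (h ▸ hw))]
    have hg1 : s1 g = conj C s := by rw [hs1, ctrlNot_apply_target, hs, zero_add]
    have hg3 : s3 g = 0 := by
      rw [hs3, ctrlNot_apply_target, hcg, hs2, hrf _ _ hgy, hg1]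
      generalize conj C s = x
      revert x; decide
    have hg4 : s4 g = 0 := by rw [hs4, hif _ _ hgy, hg3]
    have hfr : ∀ w, w ∉ ys → s4 w = s w := by
      intro w hw
      by_cases hwg : w = g
      · rw [hwg, hg4, hs]
      · rw [hs4, hif _ _ hw, hs3, hf1 _ _ hwg, hs2, hrf _ _ hw, hs1, hf1 _ _ hwg]
    rw [e4]
    refine ⟨hfr, ?_⟩
    have v1 := hrv s1
    have v4 := hrv s4
    have x1 : regVal xs s1 = regVal xs s :=
      regVal_congr fun w hw => hf1 _ _ (fun h => hgx (h ▸ hw))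
    have y1 : regVal ys s1 = regVal ys s :=
      regVal_congr fun w hw => hf1 _ _ (fun h => hgy (h ▸ hw))
    have y3 : regVal ys s3 = regVal ys s2 :=
      regVal_congr fun w hw => hf1 _ _ (fun h => hgy (h ▸ hw))
    have x4 : regVal xs s4 = regVal xs s := regVal_congr fun w hw => hfr w (hxy w hw)
    rw [x1, y1, hg1] at v1
    rw [x4, hg4, show r s4 = s3 from r.apply_symm_apply s3, y3] at v4
    have := v4.symm.trans v1
    have := Int.ModEq.add_left_cancel' (regVal xs s : ℤ)
      (show (regVal xs s : ℤ) + regVal ys s4 ≡ regVal xs s + (regVal ys s + (conj C s : ℕ))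
        [ZMOD 2 ^ ys.length] by simpa [add_assoc] using this)
    exact this
  obtain ⟨f1, v1⟩ := half lo hi p lo.toFinset hF s hglo hghi hdisj (by simpa using hdisj) hs hpf hpv
  set t := (p⁻¹ * ctrlNot lo.toFinset g hF * p * ctrlNot lo.toFinset g hF) s with ht
  obtain ⟨f2, v2⟩ := half hi lo q ∅ hX t hghi hglo (fun w h h' => hdisj w h' h) (by simp)
    (by rw [f1 g hghi, hs]) hqf hqv
  rw [Perm.mul_apply, ← ht]
  set u := (q⁻¹ * ctrlNot ∅ g hX * q * ctrlNot ∅ g hX) t with hu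
  refine ⟨fun w hw => ?_, regVal_append_modEq_succ ?_ ?_⟩
  · simp only [List.mem_append, not_or] at hw
    rw [f2 w hw.1, f1 w hw.2]
  · rwa [conj_empty, regVal_congr (s := t) (s' := s) fun w hw => f1 w (hdisj w hw)] at v2
  · rwa [regVal_congr (s := u) (s' := t) fun w hw => f2 w (fun h => hdisj w h hw)]

/-- The increment of a register with one clean work wire has linear cost. For odd length the most
significant bit is treated first, with a multi-controlled `NOT`. -/
theorem exists_increment {k : ℕ} (ws : List (Fin k)) (g : Fin k) (hn : (g :: ws).Nodup) :
    ∃ e : Perm (Bits k), ClassicalCost (24 * ws.length + 16) e ∧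
      ∀ s, s g = 0 → (∀ w, w ∉ ws → e s w = s w) ∧
        (regVal ws (e s) : ℤ) ≡ regVal ws s + 1 [ZMOD 2 ^ ws.length] := by
  have even : ∀ vs : List (Fin k), (g :: vs).Nodup → Even vs.length →
      ∃ e : Perm (Bits k), ClassicalCost (16 * vs.length + 4) e ∧
      ∀ s, s g = 0 → (∀ w, w ∉ vs → e s w = s w) ∧
        (regVal vs (e s) : ℤ) ≡ regVal vs s + 1 [ZMOD 2 ^ vs.length] := by
    rintro vs hv ⟨m, hm⟩
    have hvs := List.take_append_drop m vs
    obtain ⟨e, he, hev⟩ := exists_increment_append (lo := vs.take m) (hi := vs.drop m) (g := g)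
      (by simp; omega) (by rwa [hvs])
    rw [hvs] at hev
    exact ⟨e, he.mono (by simp; omega), hev⟩
  rcases Nat.even_or_odd ws.length with h | h
  · obtain ⟨e, he, hev⟩ := even ws hn h
    exact ⟨e, he.mono (by omega), hev⟩
  rcases List.eq_nil_or_concat' ws with rfl | ⟨vs, t, rfl⟩
  · simp at h
  have hn' : (g :: vs).Nodup ∧ g ≠ t ∧ g ∉ vs ∧ t ∉ vs ∧ vs.Nodup := by
    simp only [List.nodup_cons, List.mem_append, List.nodup_append, List.mem_singleton] at hn ⊢
    grind
  obtain ⟨hn', hgt, hgv, htv, hnv⟩ := hn'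
  obtain ⟨e, he, hev⟩ := even vs hn' (by
    rw [List.length_append, List.length_singleton] at h; grind)
  have ht : t ∉ vs.toFinset := by simpa using htv
  have hcT := classicalCost_ctrlNot (d := g) ht (by simpa using hgv) hgt
  rw [List.toFinset_card_of_nodup hnv] at hcT
  refine ⟨e * ctrlNot vs.toFinset t ht, (he.mul hcT).mono (by simp; omega), fun s hs => ?_⟩
  obtain ⟨f, v⟩ := hev (ctrlNot vs.toFinset t ht s) (by rw [ctrlNot_apply_of_ne ht hgt, hs])
  rw [Perm.mul_apply]
  refine ⟨fun w hw => ?_, regVal_append_modEq_succ ?_ ?_⟩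
  · simp only [List.mem_append, List.mem_singleton, not_or] at hw
    rw [f w hw.1, ctrlNot_apply_of_ne ht hw.2]
  · rwa [regVal_congr (s := ctrlNot vs.toFinset t ht s) (s' := s) fun w hw =>
      ctrlNot_apply_of_ne ht (fun h => htv (h ▸ hw)) s] at v
  · have hx : ∀ x y : Fin 2, ((x + y : Fin 2) : ℤ) ≡ (x : ℕ) + (y : ℕ) [ZMOD 2] := by decide
    simp only [regVal, f t htv, ctrlNot_apply_target, List.length_singleton, pow_one]
    simpa using hx (s t) (conj vs.toFinset s)

/-- Independent single-bit updates can be performed one after the other. -/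
theorem exists_update_all {k N : ℕ} {u : Fin k → Perm (Bits k)} {φ : Bits k → Fin 2}
    (ws : List (Fin k)) (hn : ws.Nodup) (hu : ∀ w ∈ ws, ∀ s, u w s = update s w (s w + φ s))
    (hφ : ∀ w ∈ ws, ∀ s v, φ (update s w v) = φ s) (hc : ∀ w ∈ ws, ClassicalCost N (u w)) :
    ∃ e : Perm (Bits k), ClassicalCost (N * ws.length) e ∧
      ∀ s w, e s w = if w ∈ ws then s w + φ s else s w := by
  induction ws with
  | nil => exact ⟨1, ClassicalCost.one, by simp⟩
  | cons a ws ih =>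
    rw [List.nodup_cons] at hn
    obtain ⟨e, he, hes⟩ := ih hn.2 (fun w hw => hu w (by simp [hw]))
      (fun w hw => hφ w (by simp [hw]))
      (fun w hw => hc w (by simp [hw]))
    refine ⟨e * u a, (he.mul (hc a (by simp))).mono (by simp [mul_add]), fun s w => ?_⟩
    rw [Perm.mul_apply, hes, hu a (by simp), hφ a (by simp)]
    by_cases hw : w = a
    · subst hw; simp [hn.1]
    · simp [hw]

/-! ### Circuits as matrices -/

open Matrix

section PermMat

variable {α : Type*} [DecidableEq α]

/-- The complex permutation matrix mapping the basis vector `|j⟩` to `|σ j⟩`. -/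
def permMat (σ : Perm α) : Matrix α α ℂ := Matrix.of fun i j => if i = σ j then 1 else 0

theorem permMat_apply (σ : Perm α) (i j : α) : permMat σ i j = if i = σ j then 1 else 0 := rfl

theorem permMat_mulVec_single [Fintype α] (σ : Perm α) (j : α) :
    permMat σ *ᵥ Pi.single j 1 = Pi.single (σ j) 1 := by
  ext i
  simp [permMat_apply, Pi.single_apply]

theorem permMat_one : permMat (1 : Perm α) = 1 := by
  ext i j
  simp only [permMat_apply, Matrix.one_apply]
  rfl

theorem permMat_mul [Fintype α] (σ τ : Perm α) : permMat (σ * τ) = permMat σ * permMat τ := by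
  ext i j
  simp only [permMat_apply, Matrix.mul_apply, mul_ite, mul_one, mul_zero, Finset.sum_ite_eq',
    Finset.mem_univ, if_true]
  rfl

theorem conjTranspose_permMat (σ : Perm α) : (permMat σ)ᴴ = permMat σ⁻¹ := by
  ext i j
  simp only [conjTranspose_apply, permMat_apply, apply_ite star, star_one, star_zero]
  congr 1
  rw [Perm.eq_inv_iff_eq]
  exact propext eq_comm

theorem permMat_mem_unitaryGroup [Fintype α] (σ : Perm α) : permMat σ ∈ unitaryGroup α ℂ := by
  rw [mem_unitaryGroup_iff, star_eq_conjTranspose, conjTranspose_permMat, ← permMat_mul,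
    mul_inv_cancel, permMat_one]

end PermMat

theorem onQubit_apply {k : ℕ} (t : Fin k) (G : Matrix (Fin 2) (Fin 2) ℂ) (y x : Bits k) :
    onQubit t G y x = if ∀ i, i ≠ t → y i = x i then G (y t) (x t) else 0 := by
  simp only [onQubit, tensor, of_apply]
  rw [← Finset.mul_prod_erase _ _ (Finset.mem_univ t), update_self]
  split_ifs with h
  · rw [Finset.prod_eq_one, mul_one]
    intro i hi
    have hi := Finset.ne_of_mem_erase hi
    rw [update_of_ne hi, h i hi, one_apply_eq]
  · push Not at h
    obtain ⟨i, hi, hne⟩ := h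
    rw [Finset.prod_eq_zero (Finset.mem_erase.2 ⟨hi, Finset.mem_univ i⟩), mul_zero]
    rw [update_of_ne hi, one_apply_ne hne]

theorem onQubit_mulVec_single {k : ℕ} (t : Fin k) (G : Matrix (Fin 2) (Fin 2) ℂ) (x : Bits k) :
    onQubit t G *ᵥ Pi.single x 1 = G 0 (x t) • Pi.single (update x t 0) 1 +
      G 1 (x t) • Pi.single (update x t 1) 1 := by
  ext y
  have hu : ∀ v, y = update x t v ↔ y t = v ∧ ∀ i, i ≠ t → y i = x i := fun v => by
    rw [eq_update_iff]
  have hb : ∀ a : Fin 2, a = 0 ∨ a = 1 := by decide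
  simp only [mulVec_single_one, col_apply, onQubit_apply, Pi.add_apply, Pi.smul_apply,
    Pi.single_apply, hu]
  rcases hb (y t) with h | h <;> simp [h]

theorem controlledNot_eq_permMat {k : ℕ} {C : Finset (Fin k)} {t : Fin k} (h : t ∉ C) :
    controlledNot C t = permMat (ctrlNot C t h) := by
  ext y x
  rw [permMat_apply, ctrlNot_apply, conj, controlledNot, of_apply]
  congr 2
  split_ifs <;> simp

theorem onQubit_pauliX_eq_permMat {k : ℕ} (t : Fin k) (h : t ∉ (∅ : Finset (Fin k))) :
    onQubit t pauliX = permMat (ctrlNot ∅ t h) := by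
  refine ext_of_mulVec_single fun x => ?_
  rw [onQubit_mulVec_single, permMat_mulVec_single, ctrlNot_apply, conj_empty]
  have hb : ∀ a : Fin 2, a = 0 ∨ a = 1 := by decide
  rcases hb (x t) with h | h <;> simp [h, pauliX]

theorem exists_gate {k : ℕ} {C : Finset (Fin k)} {t : Fin k} (h : t ∉ C) (hC : C.card ≤ 2) :
    ∃ g : Gate k, g.isClassical ∧ g.matrix = permMat (ctrlNot C t h) := by
  interval_cases hc : C.card
  · obtain rfl := Finset.card_eq_zero.1 hc
    exact ⟨.x t, rfl, onQubit_pauliX_eq_permMat t h⟩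
  · obtain ⟨c, rfl⟩ := Finset.card_eq_one.1 hc
    exact ⟨.cnot c t (by simpa [eq_comm] using h), rfl, controlledNot_eq_permMat h⟩
  · obtain ⟨c, c', hcc, rfl⟩ := Finset.card_eq_two.1 hc
    simp only [Finset.mem_insert, Finset.mem_singleton, not_or] at h
    exact ⟨.toffoli c c' t hcc (Ne.symm h.1) (Ne.symm h.2), rfl, controlledNot_eq_permMat _⟩

theorem Circuit.matrix_append {k : ℕ} (C C' : Circuit k) :
    Circuit.matrix (C ++ C') = Circuit.matrix C' * Circuit.matrix C := by
  induction C with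
  | nil => simp [Circuit.matrix]
  | cons g C ih => rw [List.cons_append, Circuit.matrix, ih, Circuit.matrix, mul_assoc]

theorem ClassicalCost.exists_circuit {k N : ℕ} {e : Perm (Bits k)} (h : ClassicalCost N e) :
    ∃ C : Circuit k, Circuit.matrix C = permMat e ∧ C.countP Gate.isZ = 0 ∧
      C.countP Gate.isHadamard = 0 ∧ C.countP Gate.isClassical ≤ N := by
  obtain ⟨L, hL, rfl, hf⟩ := h
  suffices ∃ C : Circuit k, Circuit.matrix C = permMat L.prod ∧ (∀ g ∈ C, Gate.isClassical g) ∧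
      C.length ≤ L.length by
    obtain ⟨C, h1, h2, h3⟩ := this
    refine ⟨C, h1, ?_, ?_, List.countP_le_length.trans (h3.trans hL)⟩ <;>
    · rw [List.countP_eq_zero]
      intro g hg
      have := h2 g hg
      cases g <;> simp_all [Gate.isClassical, Gate.isZ, Gate.isHadamard]
  clear hL
  induction L with
  | nil => exact ⟨[], permMat_one.symm, by simp, by simp⟩
  | cons f L ih =>
    obtain ⟨D, t, ht, hD, rfl⟩ := hf f (by simp)
    obtain ⟨C, h1, h2, h3⟩ := ih fun f' hf' => hf f' (by simp [hf'])
    obtain ⟨g, hg, hgm⟩ := exists_gate ht hD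
    refine ⟨C ++ [g], ?_, fun g' hg' => ?_, by simpa using h3⟩
    · rw [Circuit.matrix_append, h1, List.prod_cons, permMat_mul, ← hgm]
      simp [Circuit.matrix]
    · rcases List.mem_append.1 hg' with h | h
      · exact h2 g' h
      · rw [List.mem_singleton.1 h]; exact hg

/-- The computational basis state of `n` data qubits and one ancilla, the data register holding the
number `j` and the ancilla the bit `a`. -/
def dataState {n : ℕ} (j : Fin (2 ^ n)) (a : Fin 2) : Bits (n + 1) := Fin.snoc (toBits n j) a

@[simp] theorem dataState_last {n : ℕ} (j : Fin (2 ^ n)) (a : Fin 2) :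
    dataState j a (Fin.last n) = a := by simp [dataState]

@[simp] theorem dataState_castSucc {n : ℕ} (j : Fin (2 ^ n)) (a : Fin 2) (i : Fin n) :
    dataState j a i.castSucc = toBits n j i := by simp [dataState]

theorem update_dataState_last {n : ℕ} (j : Fin (2 ^ n)) (a b : Fin 2) :
    update (dataState j a) (Fin.last n) b = dataState j b :=
  Fin.update_snoc_last _ _ _

theorem eq_dataState_iff {n : ℕ} (s : Bits (n + 1)) (j : Fin (2 ^ n)) (a : Fin 2) :
    s = dataState j a ↔ s (Fin.last n) = a ∧ ∀ i : Fin n, s i.castSucc = toBits n j i := by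
  constructor
  · rintro rfl; simp
  · rintro ⟨h, h'⟩
    ext1 i
    refine Fin.lastCases ?_ (fun i => ?_) i
    · simpa using h
    · simpa using h' i

theorem withAncilla_single {n : ℕ} (j : Fin (2 ^ n)) :
    withAncilla (Pi.single j 1) = Pi.single (dataState j 0) 1 := by
  ext z
  have : z = dataState j 0 ↔ z (Fin.last n) = 0 ∧ (toBits n).symm (Fin.init z) = j := by
    rw [eq_dataState_iff, Equiv.symm_apply_eq, funext_iff]
    rfl
  simp only [withAncilla, Pi.single_apply, this]
  split_ifs <;> simp_all

/-- It suffices to check an implementation on basis states. -/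
theorem implements_of_basis {n : ℕ} {C : Circuit (n + 1)} {R : Matrix (Fin (2 ^ n)) (Fin (2 ^ n)) ℂ}
    (h : ∀ j, Circuit.matrix C *ᵥ Pi.single (dataState j 0) 1 =
      withAncilla (R *ᵥ Pi.single j 1)) : Implements C R := by
  let W : (Fin (2 ^ n) → ℂ) →ₗ[ℂ] (Bits (n + 1) → ℂ) :=
    { toFun := withAncilla
      map_add' := fun x y => by ext z; simp only [withAncilla, Pi.add_apply]; split_ifs <;> simp
      map_smul' := fun c x => by
        ext z; simp only [withAncilla, Pi.smul_apply, RingHom.id_apply]; split_ifs <;> simp }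
  have : (toLin' (Circuit.matrix C)).comp W = W.comp (toLin' R) := by
    refine (Pi.basisFun ℂ _).ext fun j => ?_
    simp only [Pi.basisFun_apply, LinearMap.comp_apply, toLin'_apply]
    exact (congrArg _ (withAncilla_single j)).trans (h j)
  exact fun ψ => LinearMap.congr_fun this ψ

/-- The `n`-qubit operator `R` can be implemented with one ancilla qubit, at most `z` gates `Z`, at
most `h` Hadamard gates and at most `N` gates of the types Toffoli, `X` and `CNOT`. -/
def Implementable {n : ℕ} (R : Matrix (Fin (2 ^ n)) (Fin (2 ^ n)) ℂ) (z h N : ℕ) : Prop :=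
  ∃ C : Circuit (n + 1), Implements C R ∧ C.countP Gate.isZ ≤ z ∧ C.countP Gate.isHadamard ≤ h ∧
    C.countP Gate.isClassical ≤ N

namespace Implementable

variable {n : ℕ} {R R' : Matrix (Fin (2 ^ n)) (Fin (2 ^ n)) ℂ} {z h N z' h' N' : ℕ}

theorem mono (H : Implementable R z h N) (hz : z ≤ z') (hh : h ≤ h') (hN : N ≤ N') :
    Implementable R z' h' N' := by
  obtain ⟨C, h1, h2, h3, h4⟩ := H
  exact ⟨C, h1, h2.trans hz, h3.trans hh, h4.trans hN⟩

theorem mul (H : Implementable R z h N) (H' : Implementable R' z' h' N') :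
    Implementable (R * R') (z + z') (h + h') (N + N') := by
  obtain ⟨C, h1, h2, h3, h4⟩ := H
  obtain ⟨C', h1', h2', h3', h4'⟩ := H'
  refine ⟨C' ++ C, fun ψ => ?_, ?_, ?_, ?_⟩
  · rw [Circuit.matrix_append, ← mulVec_mulVec, h1', h1, mulVec_mulVec]
  all_goals rw [List.countP_append]; omega

theorem of_perm {e : Perm (Bits (n + 1))} {σ : Perm (Fin (2 ^ n))} (he : ClassicalCost N e)
    (hσ : ∀ j, e (dataState j 0) = dataState (σ j) 0) : Implementable (permMat σ) 0 0 N := by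
  obtain ⟨C, h1, h2, h3, h4⟩ := he.exists_circuit
  refine ⟨C, implements_of_basis fun j => ?_, h2.le, h3.le, h4⟩
  rw [h1, permMat_mulVec_single, permMat_mulVec_single, hσ, withAncilla_single]

end Implementable

theorem implements_singleton {n : ℕ} {g : Gate (n + 1)} {G : Matrix (Fin 2) (Fin 2) ℂ} (i : Fin n)
    (hg : g.matrix = onQubit i.castSucc G) :
    Implements [g] ((onQubit i G).submatrix (toBits n) (toBits n)) := by
  refine implements_of_basis fun j => ?_
  have hm : Circuit.matrix [g] = onQubit i.castSucc G := by simp [Circuit.matrix, hg]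
  rw [hm]
  ext z
  rw [mulVec_single_one, col_apply, onQubit_apply, mulVec_single_one]
  simp only [withAncilla, col_apply, submatrix_apply, onQubit_apply, Equiv.apply_symm_apply,
    dataState_castSucc]
  have : (∀ l, l ≠ i.castSucc → z l = dataState j 0 l) ↔ z (Fin.last n) = 0 ∧
      ∀ l, l ≠ i → Fin.init z l = toBits n j l := by
    rw [Fin.forall_fin_succ']
    simp [Fin.init, and_comm, (Fin.castSucc_lt_last i).ne']
  simp only [this]
  rw [ite_and]
  rfl

theorem onLast_eq_submatrix (m : ℕ) (G : Matrix (Fin 2) (Fin 2) ℂ) :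
    onLast (m + 1) G = (onQubit (Fin.last m) G).submatrix (toBits _) (toBits _) := by
  rw [onLast, kron, onQubit]
  congr 2
  ext1 i
  by_cases h : i = Fin.last m
  · simp [h]
  · rw [update_of_ne h, if_neg]
    intro h'
    exact h (Fin.ext (by simpa using h'))

theorem implementable_onLast_pauliX {n : ℕ} (hn : 1 ≤ n) :
    Implementable (onLast n pauliX) 0 0 1 := by
  obtain ⟨m, rfl⟩ := Nat.exists_eq_add_of_le' hn
  exact ⟨[.x (Fin.last m).castSucc], onLast_eq_submatrix m _ ▸ implements_singleton _ rfl,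
    by simp [Gate.isZ], by simp [Gate.isHadamard], by simp [Gate.isClassical]⟩

theorem implementable_onLast_pauliZ {n : ℕ} (hn : 1 ≤ n) :
    Implementable (onLast n pauliZ) 1 0 0 := by
  obtain ⟨m, rfl⟩ := Nat.exists_eq_add_of_le' hn
  exact ⟨[.z (Fin.last m).castSucc], onLast_eq_submatrix m _ ▸ implements_singleton _ rfl,
    by simp [Gate.isZ], by simp [Gate.isHadamard], by simp [Gate.isClassical]⟩

/-- Phase kickback: if the classical circuit `e` flips the ancilla exactly when the bit `b j` of the
data `j` is set, then conjugating it by the preparation of the ancilla in the state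
`(|0⟩ - |1⟩) / √2` yields the diagonal operator with signs `(-1) ^ b j`. -/
theorem implementable_diagonal {n N : ℕ} {e : Perm (Bits (n + 1))} {b : Fin (2 ^ n) → Fin 2}
    (he : ClassicalCost N e) (hb : ∀ j a, e (dataState j a) = dataState j (a + b j)) :
    Implementable (diagonal fun j => if b j = 0 then (1 : ℂ) else -1) 0 2 (N + 2) := by
  obtain ⟨C, h1, h2, h3, h4⟩ := he.exists_circuit
  set t := Fin.last n
  refine ⟨[.x t, .had t] ++ C ++ [.had t, .x t], implements_of_basis fun j => ?_, ?_, ?_, ?_⟩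
  · have hX : ∀ a, onQubit t pauliX *ᵥ Pi.single (dataState j a) 1 =
        Pi.single (dataState j (a + 1)) 1 := fun a => by
      rw [onQubit_pauliX_eq_permMat t (by simp), permMat_mulVec_single, ctrlNot_apply, conj_empty,
        update_dataState_last, dataState_last]
    have hH : ∀ a, onQubit t hadamard *ᵥ Pi.single (dataState j a) 1 =
        hadamard 0 a • Pi.single (dataState j 0) 1 + hadamard 1 a • Pi.single (dataState j 1) 1 :=
      fun a => by
        rw [onQubit_mulVec_single, update_dataState_last, update_dataState_last, dataState_last]
    have hP : ∀ a, permMat e *ᵥ Pi.single (dataState j a) 1 =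
        Pi.single (dataState j (a + b j)) 1 := fun a => by
      rw [permMat_mulVec_single, hb]
    have hr : (((1 / Real.sqrt 2 : ℝ) : ℂ)) * ((1 / Real.sqrt 2 : ℝ) : ℂ) = 1 / 2 := by
      rw [← Complex.ofReal_mul, div_mul_div_comm, Real.mul_self_sqrt (by norm_num)]
      norm_num
    have hD : (diagonal fun j => if b j = 0 then (1 : ℂ) else -1) *ᵥ Pi.single j 1 =
        (if b j = 0 then (1 : ℂ) else -1) • Pi.single j 1 := by
      ext i
      rw [mulVec_diagonal]
      by_cases h : i = j
      · subst h; simp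
      · simp [h]
    have hW : ∀ (c : ℂ) (ψ : Fin (2 ^ n) → ℂ), withAncilla (c • ψ) = c • withAncilla ψ := by
      intro c ψ
      ext z
      simp [withAncilla]
    rw [hD, hW, withAncilla_single, Circuit.matrix_append, Circuit.matrix_append, h1]
    simp only [Circuit.matrix, Gate.matrix, one_mul, ← mulVec_mulVec, hX, hH, mulVec_add,
      mulVec_smul, hP]
    set r : ℂ := ((1 / Real.sqrt 2 : ℝ) : ℂ) with hrdef
    have hbj : ∀ a : Fin 2, a = 0 ∨ a = 1 := by decide
    have hh : hadamard 0 0 = r ∧ hadamard 0 1 = r ∧ hadamard 1 0 = r ∧ hadamard 1 1 = -r := by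
      simp [hadamard, hrdef]
    have h11 : (1 : Fin 2) + 1 = 0 := rfl
    rcases hbj (b j) with h | h <;>
      simp only [h, zero_add, add_zero, h11, hh.1, hh.2.1, hh.2.2.1, hh.2.2.2]
    · ext z
      simp only [Pi.add_apply, Pi.smul_apply, smul_eq_mul, if_true]
      linear_combination (2 * (Pi.single (dataState j 0) 1 : Bits (n + 1) → ℂ) z) * hr
    · ext z
      simp only [Pi.add_apply, Pi.smul_apply, smul_eq_mul, one_ne_zero, if_false]
      linear_combination (-2 * (Pi.single (dataState j 0) 1 : Bits (n + 1) → ℂ) z) * hr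
  all_goals
    simp only [List.countP_append, List.countP_cons, List.countP_nil, Gate.isZ, Gate.isHadamard,
      Gate.isClassical, h2, h3]
    simp <;> omega

/-! ### Bits of numbers -/

theorem toBits_symm_val {n : ℕ} (x : Bits n) :
    (((toBits n).symm x : Fin (2 ^ n)) : ℕ) = ∑ i : Fin n, (x i.rev : ℕ) * 2 ^ (i : ℕ) := by
  simp [toBits]

theorem toBits_val {n : ℕ} (j : Fin (2 ^ n)) (i : Fin n) :
    (toBits n j i : ℕ) = j / 2 ^ (n - 1 - i : ℕ) % 2 := by
  simp [toBits, finFunctionFinEquiv_symm_apply_val, Fin.val_rev, Nat.sub_sub, add_comm]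

/-- Reversing the order of the basis negates every bit. -/
theorem toBits_rev {n : ℕ} (j : Fin (2 ^ n)) (i : Fin n) : toBits n j.rev i = toBits n j i + 1 := by
  -- `j` and the number with the complementary bits add up to `2 ^ n - 1`
  suffices j.rev = (toBits n).symm fun i => toBits n j i + 1 by rw [this, apply_symm_apply]
  have h1 := toBits_symm_val fun i => toBits n j i + 1
  have h2 := toBits_symm_val (toBits n j)
  rw [symm_apply_apply] at h2
  have hb : ∀ a : Fin 2, ((a + 1 : Fin 2) : ℕ) + (a : ℕ) = 1 := by decide
  have h3 : ∑ i : Fin n, ((toBits n j i.rev + 1 : Fin 2) : ℕ) * 2 ^ (i : ℕ) +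
      ∑ i : Fin n, (toBits n j i.rev : ℕ) * 2 ^ (i : ℕ) + 1 = 2 ^ n := by
    rw [← Finset.sum_add_distrib]
    simp only [← add_mul, hb]
    rw [Fin.sum_univ_eq_sum_range fun i => 1 * 2 ^ i]
    simpa [one_add_one_eq_two] using geom_sum_mul_add (1 : ℕ) n
  rw [← h1, ← h2] at h3
  ext
  rw [Fin.val_rev]
  omega

theorem toBits_zero {n : ℕ} (i : Fin n) : toBits n 0 i = 0 := by
  ext
  rw [toBits_val]
  simp

theorem toBits_eq_zero_iff {n : ℕ} (j : Fin (2 ^ n)) : (∀ i, toBits n j i = 0) ↔ (j : ℕ) = 0 := by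
  rw [Fin.val_eq_zero_iff, ← (toBits n).injective.eq_iff, funext_iff]
  simp only [toBits_zero]

theorem toBits_eq_one_iff {n : ℕ} (j : Fin (2 ^ n)) :
    (∀ i, toBits n j i = 1) ↔ (j : ℕ) + 1 = 2 ^ n := by
  have h := toBits_eq_zero_iff j.rev
  have hb : ∀ a : Fin 2, a + 1 = 0 ↔ a = 1 := by decide
  simp only [toBits_rev, hb, Fin.val_rev] at h
  rw [h]
  omega

/-- Dropping the last bit halves the number. -/
theorem toBits_castSucc {m : ℕ} (j : Fin (2 ^ (m + 1))) (i : Fin m) :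
    toBits (m + 1) j i.castSucc =
      toBits m ⟨j / 2, by have := j.2; have := pow_succ 2 m; omega⟩ i := by
  ext
  rw [toBits_val, toBits_val, Nat.div_div_eq_div_mul, ← pow_succ']
  congr 3
  simp only [Fin.val_castSucc]
  omega

theorem toBits_last {m : ℕ} (j : Fin (2 ^ (m + 1))) :
    (toBits (m + 1) j (Fin.last m) : ℕ) = j % 2 := by
  rw [toBits_val]
  simp

/-- The wires of the data register, the least significant bit first. -/
def dataWires (n : ℕ) : List (Fin (n + 1)) := List.ofFn fun i : Fin n => i.rev.castSucc

theorem dataWires_length (n : ℕ) : (dataWires n).length = n := by simp [dataWires]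

theorem mem_dataWires {n : ℕ} (w : Fin (n + 1)) : w ∈ dataWires n ↔ w ≠ Fin.last n := by
  refine Fin.lastCases ?_ (fun i => ?_) w
  · simp [dataWires, List.mem_ofFn]
  · simp only [dataWires, List.mem_ofFn, Fin.castSucc_inj]
    exact ⟨fun _ => (Fin.castSucc_lt_last i).ne, fun _ => ⟨i.rev, by simp⟩⟩

theorem dataWires_nodup (n : ℕ) : (Fin.last n :: dataWires n).Nodup := by
  rw [List.nodup_cons, mem_dataWires]
  refine ⟨by simp, List.nodup_ofFn.2 fun i j h => ?_⟩
  simpa using h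

theorem regVal_ofFn {k n : ℕ} (w : Fin n → Fin k) (s : Bits k) :
    regVal (List.ofFn w) s = ∑ i, (s (w i) : ℕ) * 2 ^ (i : ℕ) := by
  induction n with
  | zero => simp [regVal]
  | succ n ih =>
    rw [List.ofFn_succ, regVal, ih, Fin.sum_univ_succ, Finset.mul_sum]
    simp only [Fin.val_zero, pow_zero, mul_one, Fin.val_succ, pow_succ]
    congr 1
    exact Finset.sum_congr rfl fun i _ => by ring

theorem regVal_dataWires {n : ℕ} (s : Bits (n + 1)) :
    regVal (dataWires n) s = ((toBits n).symm (Fin.init s) : Fin (2 ^ n)) := by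
  rw [toBits_symm_val, dataWires, regVal_ofFn]
  rfl

theorem regVal_dataState {n : ℕ} (j : Fin (2 ^ n)) (a : Fin 2) :
    regVal (dataWires n) (dataState j a) = j := by
  rw [regVal_dataWires, dataState, Fin.init_snoc, symm_apply_apply]

theorem eq_dataState_of_regVal {n : ℕ} {s : Bits (n + 1)} {j : Fin (2 ^ n)}
    (h : regVal (dataWires n) s = j) : s = dataState j (s (Fin.last n)) := by
  rw [regVal_dataWires] at h
  rw [← Fin.ext h, dataState, apply_symm_apply, Fin.snoc_init_self]

/-! ### The terms as permutation and diagonal matrices -/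

theorem xAll_eq_permMat (n : ℕ) : xAll n = permMat Fin.revPerm := by
  ext i j
  simp only [xAll, kron, tensor, submatrix_apply, of_apply, permMat_apply, Fin.revPerm_apply]
  have hX : ∀ a b : Fin 2, pauliX a b = if a = b + 1 then 1 else 0 := by
    intro a b
    fin_cases a <;> fin_cases b <;> simp [pauliX]
  simp only [hX, Finset.prod_ite_zero, Finset.prod_const_one, Finset.mem_univ, true_imp_iff]
  congr 1
  rw [← (toBits n).injective.eq_iff (a := i), funext_iff]
  simp only [toBits_rev]

theorem increment_eq_permMat (n : ℕ) : increment n = permMat (Equiv.addRight 1) := by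
  ext i j
  simp only [increment, of_apply, permMat_apply, coe_addRight, Fin.ext_iff, Fin.val_add,
    Fin.val_one', Nat.add_mod_mod]

/-- The diagonal of `X^{⊗ n} C_n⁻`. -/
def endSign (n : ℕ) (j : Fin (2 ^ n)) : ℂ := if (j : ℕ) = 0 ∨ (j : ℕ) + 1 = 2 ^ n then 1 else -1

theorem xAll_mul_apply {n : ℕ} (M : Matrix (Fin (2 ^ n)) (Fin (2 ^ n)) ℂ) (i j : Fin (2 ^ n)) :
    (xAll n * M) i j = M i.rev j := by
  rw [xAll_eq_permMat, mul_apply]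
  simp only [permMat_apply, Fin.revPerm_apply, ite_mul, one_mul, zero_mul]
  rw [Finset.sum_eq_single i.rev]
  · simp
  · intro b _ hb
    rw [if_neg]
    rintro rfl
    simp at hb
  · simp

theorem xAll_mul_antidiagSign (n : ℕ) : xAll n * antidiagSign n = diagonal (endSign n) := by
  ext i j
  simp only [xAll_mul_apply, antidiagSign, of_apply, diagonal_apply, endSign, Fin.ext_iff,
    Fin.val_rev]
  have hi := i.2
  have hj := j.2
  by_cases h : (i : ℕ) = j
  · rw [if_pos (by omega), if_pos h]
    exact if_congr (by omega) rfl rfl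
  · rw [if_neg (by omega), if_neg h]

theorem antidiagSign_eq (n : ℕ) : antidiagSign n = xAll n * diagonal (endSign n) := by
  rw [← xAll_mul_antidiagSign, ← mul_assoc, xAll_eq_permMat, ← permMat_mul]
  have : (Fin.revPerm * Fin.revPerm : Perm (Fin (2 ^ n))) = 1 := by ext; simp
  rw [this, permMat_one, one_mul]

theorem onLast_apply {n : ℕ} (hn : 1 ≤ n) (G : Matrix (Fin 2) (Fin 2) ℂ) (i j : Fin (2 ^ n)) :
    onLast n G i j = if (i : ℕ) / 2 = j / 2 then
      G ⟨i % 2, Nat.mod_lt _ two_pos⟩ ⟨j % 2, Nat.mod_lt _ two_pos⟩ else 0 := by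
  obtain ⟨m, rfl⟩ := Nat.exists_eq_add_of_le' hn
  rw [onLast_eq_submatrix, submatrix_apply, onQubit_apply]
  have h1 : (∀ l, l ≠ Fin.last m → toBits _ i l = toBits _ j l) ↔ (i : ℕ) / 2 = j / 2 := by
    rw [Fin.forall_fin_succ']
    simp only [(Fin.castSucc_lt_last _).ne, ne_eq, not_false_eq_true, true_imp_iff,
      not_true_eq_false, false_imp_iff, and_true, toBits_castSucc]
    rw [← funext_iff, (toBits m).injective.eq_iff, Fin.mk.injEq]
  have h2 : ∀ j, toBits (m + 1) j (Fin.last m) = ⟨j % 2, Nat.mod_lt _ two_pos⟩ := fun j =>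
    Fin.ext (toBits_last j)
  simp only [h1, h2]

theorem onLast_pauliX_apply {n : ℕ} (hn : 1 ≤ n) (i j : Fin (2 ^ n)) :
    onLast n pauliX i j = if (i : ℕ) / 2 = j / 2 ∧ (i : ℕ) ≠ j then 1 else 0 := by
  rw [onLast_apply hn, ite_and]
  refine if_ctx_congr Iff.rfl (fun h => ?_) fun _ => rfl
  rcases Nat.mod_two_eq_zero_or_one i with hi | hi <;>
    rcases Nat.mod_two_eq_zero_or_one j with hj | hj <;>
    simp only [hi, hj, pauliX]
  · rw [if_neg (by omega)]; rfl
  · rw [if_pos (by omega)]; rfl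
  · rw [if_pos (by omega)]; rfl
  · rw [if_neg (by omega)]; rfl

theorem onLast_pauliZ_apply {n : ℕ} (hn : 1 ≤ n) (i j : Fin (2 ^ n)) :
    onLast n pauliZ i j = if (i : ℕ) = j then (if (i : ℕ) % 2 = 0 then 1 else -1) else 0 := by
  rw [onLast_apply hn]
  by_cases h : (i : ℕ) = j
  · rw [if_pos (by omega), if_pos h]
    rcases Nat.mod_two_eq_zero_or_one i with hi | hi <;>
      simp [← h, hi, pauliZ]
  · rw [if_neg h]
    split_ifs with h'
    · rcases Nat.mod_two_eq_zero_or_one i with hi | hi <;>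
        rcases Nat.mod_two_eq_zero_or_one j with hj | hj <;>
        simp only [hi, hj, pauliZ]
      · omega
      · rfl
      · rfl
      · omega
    · rfl

/-! ### Unitarity -/

theorem tensor_mul {k : ℕ} (M M' : Fin k → Matrix (Fin 2) (Fin 2) ℂ) :
    tensor M * tensor M' = tensor fun i => M i * M' i := by
  ext x y
  simp only [tensor, mul_apply, of_apply, ← Finset.prod_mul_distrib, Finset.prod_univ_sum,
    Fintype.piFinset_univ]

theorem tensor_one (k : ℕ) : tensor (fun _ : Fin k => (1 : Matrix (Fin 2) (Fin 2) ℂ)) = 1 := by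
  ext x y
  simp only [tensor, of_apply, one_apply, Finset.prod_ite_zero, Finset.prod_const_one,
    Finset.mem_univ, true_imp_iff, funext_iff]

theorem kron_mem_unitaryGroup {k : ℕ} {M : Fin k → Matrix (Fin 2) (Fin 2) ℂ}
    (h : ∀ i, M i ∈ unitaryGroup (Fin 2) ℂ) : kron M ∈ unitaryGroup (Fin (2 ^ k)) ℂ := by
  have hs : star (kron M) = kron fun i => star (M i) := by
    ext x y
    simp [kron, tensor]
  rw [mem_unitaryGroup_iff, hs, kron, kron, submatrix_mul_equiv, tensor_mul]
  simp only [mem_unitaryGroup_iff.1 (h _), tensor_one, submatrix_one_equiv]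

theorem onLast_mem_unitaryGroup (n : ℕ) {G : Matrix (Fin 2) (Fin 2) ℂ}
    (h : G ∈ unitaryGroup (Fin 2) ℂ) : onLast n G ∈ unitaryGroup (Fin (2 ^ n)) ℂ := by
  refine kron_mem_unitaryGroup fun i => ?_
  split_ifs
  exacts [h, one_mem _]

theorem pauliX_mem_unitaryGroup : pauliX ∈ unitaryGroup (Fin 2) ℂ := by
  rw [mem_unitaryGroup_iff]
  ext i j
  fin_cases i <;> fin_cases j <;> simp [pauliX, mul_apply, star_eq_conjTranspose]

theorem pauliZ_mem_unitaryGroup : pauliZ ∈ unitaryGroup (Fin 2) ℂ := by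
  rw [mem_unitaryGroup_iff]
  ext i j
  fin_cases i <;> fin_cases j <;> simp [pauliZ, mul_apply, star_eq_conjTranspose]

theorem diagonal_endSign_mem_unitaryGroup (n : ℕ) :
    diagonal (endSign n) ∈ unitaryGroup (Fin (2 ^ n)) ℂ := by
  rw [mem_unitaryGroup_iff, star_eq_conjTranspose, diagonal_conjTranspose, diagonal_mul_diagonal,
    ← diagonal_one]
  congr 1
  ext1 j
  simp only [Pi.star_apply, endSign]
  split_ifs <;> simp

theorem lcuTerm_mem_unitaryGroup (n : ℕ) (l : Fin 10) :
    lcuTerm n l ∈ unitaryGroup (Fin (2 ^ n)) ℂ := by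
  have hX := onLast_mem_unitaryGroup n pauliX_mem_unitaryGroup
  have hZ := onLast_mem_unitaryGroup n pauliZ_mem_unitaryGroup
  have hA : xAll n ∈ unitaryGroup (Fin (2 ^ n)) ℂ := xAll_eq_permMat n ▸ permMat_mem_unitaryGroup _
  have hS : increment n ∈ unitaryGroup (Fin (2 ^ n)) ℂ :=
    increment_eq_permMat n ▸ permMat_mem_unitaryGroup _
  have hD := diagonal_endSign_mem_unitaryGroup n
  have hC : antidiagSign n ∈ unitaryGroup (Fin (2 ^ n)) ℂ :=
    antidiagSign_eq n ▸ mul_mem hA hD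
  have hAC := mul_mem hA hC
  fin_cases l
  exacts [one_mem _, hX, hA, hZ, hS, Unitary.star_mem hS, hC, hAC, mul_mem hAC hZ, mul_mem hAC hX]

/-! ### The decomposition -/

theorem increment_apply {n : ℕ} (i j : Fin (2 ^ n)) : increment n i j =
    if (i : ℕ) = j + 1 ∨ ((i : ℕ) = 0 ∧ (j : ℕ) + 1 = 2 ^ n) then 1 else 0 := by
  rw [increment, of_apply]
  refine if_congr ?_ rfl rfl
  have hi := i.2
  have hj := j.2
  rcases (show (j : ℕ) + 1 < 2 ^ n ∨ (j : ℕ) + 1 = 2 ^ n by omega) with h | h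
  · rw [Nat.mod_eq_of_lt h]; omega
  · rw [h, Nat.mod_self]; omega

/-- Multiplying by `h²` cancels the factor `1 / h²` because `h ≠ 0`, which needs `n ≥ 1`. -/
theorem neumannRobinMatrix_apply {n : ℕ} (hn : 1 ≤ n) (a₀ a₁ : ℝ) (i j : Fin (2 ^ n)) :
    neumannRobinMatrix n a₀ a₁ i j =
    if i = j then
      if (i : ℕ) = 0 then -2 + 2 * a₀ * meshWidth n
      else if (i : ℕ) + 1 = 2 ^ n then -2 - 2 * a₁ * meshWidth n
      else -2
    else if (j : ℕ) = i + 1 then (if (i : ℕ) = 0 then 2 else 1)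
    else if (i : ℕ) = j + 1 then (if (i : ℕ) + 1 = 2 ^ n then 2 else 1)
    else 0 := by
  have h : meshWidth n ≠ 0 := by
    have : (1 : ℝ) < 2 ^ n := one_lt_pow₀ one_lt_two (by omega)
    exact one_div_ne_zero (by linarith)
  rw [neumannRobinMatrix, neumannRobinLaplacian, smul_smul, mul_one_div_cancel (pow_ne_zero 2 h),
    one_smul, of_apply]

theorem neumannRobinMatrix_eq_sum {n : ℕ} (hn : 1 ≤ n) (a₀ a₁ : ℝ) :
    (neumannRobinMatrix n a₀ a₁).map Complex.ofReal =
      ∑ l : Fin 10, (lcuCoeff n a₀ a₁ l : ℂ) • lcuTerm n l := by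
  have hsum : ∀ f : Fin 10 → Matrix (Fin (2 ^ n)) (Fin (2 ^ n)) ℂ, ∑ l, f l =
      f 0 + f 1 + f 2 + f 3 + f 4 + f 5 + f 6 + f 7 + f 8 + f 9 := fun f => by
    rw [Fin.sum_univ_castSucc, Fin.sum_univ_castSucc, Fin.sum_univ_eight]; rfl
  ext i j
  -- evenness of the size ensures that rows `0` and `2 ^ n - 1` have opposite `Z`-signs and that no
  -- entry lies on both the diagonal and the antidiagonal
  obtain ⟨M, hM⟩ : ∃ M, 2 ^ n = 2 * M := ⟨2 ^ (n - 1), by rw [← pow_succ']; congr 1; omega⟩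
  have hi := i.2
  have hj := j.2
  rw [map_apply, neumannRobinMatrix_apply hn, hsum]
  set h := meshWidth n
  change _ = ((((-4 + (a₀ - a₁) * h) / 2 : ℝ) : ℂ) • (1 : Matrix (Fin (2 ^ n)) (Fin (2 ^ n)) ℂ) +
    ((1 / 2 : ℝ) : ℂ) • onLast n pauliX + ((-1 / 2 : ℝ) : ℂ) • xAll n +
    (((a₀ + a₁) * h / 2 : ℝ) : ℂ) • onLast n pauliZ + ((1 : ℝ) : ℂ) • increment n +
    ((1 : ℝ) : ℂ) • (increment n)ᴴ + ((-1 / 2 : ℝ) : ℂ) • antidiagSign n +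
    (((a₀ - a₁) * h / 2 : ℝ) : ℂ) • (xAll n * antidiagSign n) +
    (((a₀ + a₁) * h / 2 : ℝ) : ℂ) • (xAll n * antidiagSign n * onLast n pauliZ) +
    ((1 / 2 : ℝ) : ℂ) • (xAll n * antidiagSign n * onLast n pauliX)) i j
  have hx : xAll n i j = if (i : ℕ) + j + 1 = 2 ^ n then 1 else 0 := by
    rw [xAll_eq_permMat, permMat_apply]
    refine if_congr ?_ rfl rfl
    rw [Fin.revPerm_apply, Fin.ext_iff, Fin.val_rev]; omega
  have hs : (increment n)ᴴ i j =
      if (j : ℕ) = i + 1 ∨ ((j : ℕ) = 0 ∧ (i : ℕ) + 1 = 2 ^ n) then 1 else 0 := by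
    rw [conjTranspose_apply, increment_apply]
    split_ifs <;> simp
  have hc : antidiagSign n i j = if (i : ℕ) + j + 1 = 2 ^ n then
    (if (i : ℕ) = 0 ∨ (j : ℕ) = 0 then 1 else -1) else 0 := rfl
  simp only [Matrix.add_apply, Matrix.smul_apply, xAll_mul_antidiagSign, diagonal_mul,
    diagonal_apply, one_apply, smul_eq_mul, hx, hs, hc, increment_apply, onLast_pauliX_apply hn,
    onLast_pauliZ_apply hn, endSign, Fin.ext_iff]
  clear hx hs hc hsum
  clear_value h
  generalize (i : ℕ) = x at *
  generalize (j : ℕ) = y at *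
  generalize 2 ^ n = N at *
  by_cases hxy : x = y
  · subst hxy
    simp only [if_true, ne_eq, not_true_eq_false, and_false, if_false, show x ≠ x + 1 by omega,
      show x + x + 1 ≠ N by omega]
    by_cases h0 : x = 0
    · simp only [h0, if_true, true_and, show 0 + 1 ≠ N by omega, if_false, or_false,
        Nat.zero_mod]
      push_cast
      ring
    by_cases hN : x + 1 = N
    · simp only [h0, hN, if_true, or_true, if_false, false_and, or_false,
        show ¬ x % 2 = 0 by omega]
      push_cast
      ring
    · simp only [h0, hN, if_false, and_false, or_false]
      split_ifs <;> push_cast <;> ring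
  · simp only [hxy, if_false, ne_eq, not_false_eq_true, and_true, mul_zero]
    by_cases h1 : y = x + 1
    · subst h1
      simp only [if_true, true_or, show ¬ x = x + 1 + 1 by omega, Nat.succ_ne_zero,
        or_false, false_or]
      split_ifs <;> first | (exfalso; omega) | (push_cast; ring)
    by_cases h2 : x = y + 1
    · subst h2
      simp only [if_true, true_or, Nat.succ_ne_zero, false_or]
      split_ifs <;> first | (exfalso; omega) | (push_cast; ring)
    simp only [h1, h2, if_false, false_or, show ¬ x / 2 = y / 2 by omega]
    split_ifs <;> first | (exfalso; omega) | (push_cast; ring)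

/-! ### Implementing the terms -/

theorem implementable_one (n : ℕ) :
    Implementable (1 : Matrix (Fin (2 ^ n)) (Fin (2 ^ n)) ℂ) 0 0 0 :=
  ⟨[], fun ψ => by simp [Circuit.matrix], by simp, by simp, by simp⟩

theorem implementable_xAll (n : ℕ) : Implementable (xAll n) 0 0 n := by
  have hX : ∀ w : Fin (n + 1), w ∉ (∅ : Finset (Fin (n + 1))) := by simp
  obtain ⟨e, he, hes⟩ := exists_update_all (u := fun w => ctrlNot ∅ w (hX w)) (φ := fun _ => 1)
    (N := 1) (dataWires n) (dataWires_nodup n).of_cons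
    (fun w _ s => by rw [ctrlNot_apply, conj_empty]) (fun _ _ _ _ => rfl)
    (fun w _ => ClassicalCost.ctrlNot (hX w) (by simp))
  rw [xAll_eq_permMat]
  refine Implementable.of_perm (he.mono (by rw [dataWires_length, one_mul])) fun j => ?_
  rw [eq_dataState_iff]
  refine ⟨?_, fun i => ?_⟩
  · rw [hes, if_neg (by rw [mem_dataWires]; simp), dataState_last]
  · rw [hes, if_pos (by rw [mem_dataWires]; exact (Fin.castSucc_lt_last i).ne), dataState_castSucc,
      Fin.revPerm_apply, toBits_rev]

theorem exists_increment_dataState (n : ℕ) :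
    ∃ e : Perm (Bits (n + 1)), ClassicalCost (24 * n + 16) e ∧
      ∀ j : Fin (2 ^ n), e (dataState j 0) = dataState (j + 1) 0 := by
  obtain ⟨e, he, hes⟩ := exists_increment (dataWires n) (Fin.last n) (dataWires_nodup n)
  rw [dataWires_length] at he
  refine ⟨e, he, fun j => ?_⟩
  obtain ⟨hf, hv⟩ := hes (dataState j 0) (dataState_last j 0)
  have h0 : e (dataState j 0) (Fin.last n) = 0 := by
    rw [hf _ (by rw [mem_dataWires]; simp), dataState_last]
  rw [regVal_dataState, dataWires_length] at hv
  have hv' : regVal (dataWires n) (e (dataState j 0)) ≡ j + 1 [MOD 2 ^ n] := by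
    rw [← Int.natCast_modEq_iff]; exact_mod_cast hv
  have hlt := regVal_lt (dataWires n) (e (dataState j 0))
  rw [dataWires_length] at hlt
  have := eq_dataState_of_regVal (s := e (dataState j 0)) (j := j + 1) (by
    rw [← Nat.mod_eq_of_lt hlt, hv', Fin.val_add, Fin.val_one', Nat.add_mod_mod])
  rwa [h0] at this

theorem implementable_increment (n : ℕ) : Implementable (increment n) 0 0 (24 * n + 16) := by
  obtain ⟨e, he, hes⟩ := exists_increment_dataState n
  rw [increment_eq_permMat]
  exact .of_perm he hes

theorem implementable_increment_conjTranspose (n : ℕ) :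
    Implementable (increment n)ᴴ 0 0 (24 * n + 16) := by
  obtain ⟨e, he, hes⟩ := exists_increment_dataState n
  rw [increment_eq_permMat, conjTranspose_permMat]
  -- Running the circuit backwards also restores the clean ancilla.
  refine .of_perm he.inv fun j => ?_
  rw [Perm.inv_eq_iff_eq, hes]
  congr 1
  exact ((Equiv.addRight (1 : Fin (2 ^ n))).apply_symm_apply j).symm

/-- The signs are kicked back from an ancilla that is flipped unless all data bits are equal.
Adding the last data bit to the others turns equality into a conjunction of the other bits, so that
the last data wire can be borrowed. -/
theorem implementable_diagonal_endSign {n : ℕ} (hn : 1 ≤ n) :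
    Implementable (diagonal (endSign n)) 0 2 (12 * n + 15) := by
  obtain ⟨m, rfl⟩ := Nat.exists_eq_add_of_le' hn
  set t := Fin.last (m + 1)
  set d : Fin (m + 2) := (Fin.last m).castSucc
  have hdt : d ≠ t := (Fin.castSucc_lt_last _).ne
  set ws : List (Fin (m + 2)) := List.ofFn fun i : Fin m => i.castSucc.castSucc with hws
  have hwn : ws.Nodup := List.nodup_ofFn.2 fun i j h => by simpa using h
  have hmem : ∀ w, w ∈ ws ↔ ∃ i : Fin m, i.castSucc.castSucc = w := by simp [hws, List.mem_ofFn]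
  have hdw : d ∉ ws := by
    rw [hmem]
    rintro ⟨i, hi⟩
    exact (Fin.castSucc_lt_last i).ne (Fin.castSucc_injective _ hi)
  have htw : t ∉ ws := by
    rw [hmem]
    rintro ⟨i, hi⟩
    exact (Fin.castSucc_lt_last _).ne hi
  have hX : ∀ w : Fin (m + 2), w ∉ (∅ : Finset (Fin (m + 2))) := by simp
  -- The other data bits become their negated differences to bit `d`, so that their conjunction
  -- says that all data bits are equal.
  obtain ⟨W, hW, hWs⟩ := exists_update_all (k := m + 2) (N := 2)
    (u := fun w => if h : w ∉ ({d} : Finset _) then ctrlNot {d} w h * ctrlNot ∅ w (hX w) else 1)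
    (φ := fun s => 1 + s d) ws hwn
    (fun w hw s => by
      have h : w ≠ d := fun h => hdw (h ▸ hw)
      rw [dif_pos (by simpa using h), Perm.mul_apply, ctrlNot_apply, ctrlNot_apply, conj_singleton,
        conj_empty, update_self, update_idem, update_of_ne h.symm, add_assoc])
    (fun w hw s v => by
      have h : d ≠ w := fun h => hdw (h ▸ hw)
      rw [update_of_ne h])
    (fun w hw => by
      have h : w ≠ d := fun h => hdw (h ▸ hw)
      rw [dif_pos (by simpa using h)]
      exact (ClassicalCost.ctrlNot _ (by simp)).mul (ClassicalCost.ctrlNot _ (by simp)))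
  have ht : t ∉ ws.toFinset := by simpa using htw
  have hc := classicalCost_ctrlNot (d := d) ht (by simpa using hdw) hdt
  have hlen : ws.length = m := by simp [hws]
  rw [List.toFinset_card_of_nodup hwn, hlen] at hc
  rw [hlen] at hW
  have hcost := (ClassicalCost.ctrlNot (hX t) (by simp)).mul ((hW.inv.mul hc).mul hW)
  have hval : ∀ s, (ctrlNot ∅ t (hX t) * (W⁻¹ * ctrlNot ws.toFinset t ht * W)) s =
      update s t (s t + (1 + conj ws.toFinset (W s))) := by
    intro s
    have h1 : (W⁻¹ * ctrlNot ws.toFinset t ht * W) s =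
        update s t (s t + conj ws.toFinset (W s)) := by
      rw [Perm.mul_apply, Perm.mul_apply, Perm.inv_eq_iff_eq, ctrlNot_apply]
      ext1 w
      by_cases hw : w = t
      · subst hw
        simp [hWs, htw]
      · rw [update_of_ne hw, hWs, hWs, update_of_ne hw, update_of_ne hdt]
    rw [Perm.mul_apply, h1, ctrlNot_apply, conj_empty, update_self, update_idem,
      show ∀ a b : Fin 2, a + b + 1 = a + (1 + b) by decide]
  -- the condition does not depend on the ancilla
  have hb : ∀ j : Fin (2 ^ (m + 1)), ∀ a a', conj ws.toFinset (W (dataState j a)) =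
      conj ws.toFinset (W (dataState j a')) := fun j a a' => conj_congr fun w hw => by
    rw [List.mem_toFinset] at hw
    obtain ⟨i, rfl⟩ := (hmem w).1 hw
    simp only [hWs, d, dataState_castSucc]
  have key := implementable_diagonal hcost
    (b := fun j => 1 + conj ws.toFinset (W (dataState j 0))) fun j a => by
      rw [hval, update_dataState_last, dataState_last, hb j a 0]
  have hD : endSign (m + 1) = fun j =>
      if 1 + conj ws.toFinset (W (dataState j 0)) = 0 then (1 : ℂ) else -1 := by
    ext1 j
    rw [endSign]
    refine if_congr ?_ rfl rfl
    have hb2 : ∀ a : Fin 2, 1 + a = 0 ↔ a = 1 := by decide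
    have hb3 : ∀ a b : Fin 2, a + (1 + b) = 1 ↔ a = b := by decide
    have hb4 : ∀ a : Fin 2, a = 0 ∨ a = 1 := by decide
    have hconj : ∀ s : Bits (m + 2), conj ws.toFinset s = 1 ↔ ∀ w ∈ ws, s w = 1 := by
      intro s
      simp [conj]
    have hall : (∀ w ∈ ws, W (dataState j 0) w = 1) ↔
        ∀ i, toBits (m + 1) j i = toBits (m + 1) j (Fin.last m) := by
      rw [Fin.forall_fin_succ' (P := fun i => toBits (m + 1) j i = toBits (m + 1) j (Fin.last m))]
      simp only [hmem, forall_exists_index, forall_apply_eq_imp_iff, and_true]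
      refine forall_congr' fun i => ?_
      rw [hWs, if_pos ((hmem _).2 ⟨i, rfl⟩), hb3, dataState_castSucc, dataState_castSucc]
    rw [hb2, hconj, hall, ← toBits_eq_zero_iff, ← toBits_eq_one_iff]
    constructor
    · rintro (h | h) i <;> rw [h, h]
    · intro h
      rcases hb4 (toBits (m + 1) j (Fin.last m)) with h' | h'
      · exact Or.inl fun i => by rw [h, h']
      · exact Or.inr fun i => by rw [h, h']
  rw [hD]
  exact key.mono le_rfl le_rfl (by omega)

theorem implementable_lcuTerm {n : ℕ} (hn : 1 ≤ n) (l : Fin 10) :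
    Implementable (lcuTerm n l) 1 2 (40 * n) := by
  have hX := implementable_onLast_pauliX hn
  have hZ := implementable_onLast_pauliZ hn
  have hA := implementable_xAll n
  have hD := implementable_diagonal_endSign hn
  have hC := antidiagSign_eq n ▸ hA.mul hD
  have hAC := (xAll_mul_antidiagSign n).symm ▸ hD
  fin_cases l
  · exact (implementable_one n).mono (by omega) (by omega) (by omega)
  · exact hX.mono (by omega) (by omega) (by omega)
  · exact hA.mono (by omega) (by omega) (by omega)
  · exact hZ.mono (by omega) (by omega) (by omega)
  · exact (implementable_increment n).mono (by omega) (by omega) (by omega)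
  · exact (implementable_increment_conjTranspose n).mono (by omega) (by omega) (by omega)
  · exact hC.mono (by omega) (by omega) (by omega)
  · exact hAC.mono (by omega) (by omega) (by omega)
  · exact (hAC.mul hZ).mono (by omega) (by omega) (by omega)
  · exact (hAC.mul hX).mono (by omega) (by omega) (by omega)

end NRPoisson

open NRPoisson in
theorem theorem2 :
    -- the explicit decomposition into ten unitaries with real coefficients
    (∀ n : ℕ, 1 ≤ n →
      (∀ a₀ a₁ : ℝ, (neumannRobinMatrix n a₀ a₁).map Complex.ofReal =
        ∑ l : Fin 10, (lcuCoeff n a₀ a₁ l : ℂ) • lcuTerm n l) ∧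
      ∀ l : Fin 10, lcuTerm n l ∈ Matrix.unitaryGroup (Fin (2 ^ n)) ℂ) ∧
    -- gate counts with one ancilla qubit; the constant `K` is absolute
    ∃ K : ℕ, ∀ n : ℕ, 1 ≤ n → ∀ l : Fin 10, ∃ C : Circuit (n + 1),
      Implements C (lcuTerm n l) ∧
      C.countP Gate.isZ ≤ 1 ∧
      C.countP Gate.isHadamard ≤ 2 ∧
      C.countP Gate.isClassical ≤ K * n :=
  ⟨fun _ hn => ⟨neumannRobinMatrix_eq_sum hn, lcuTerm_mem_unitaryGroup _⟩,
    40, fun _ hn l => implementable_lcuTerm hn l⟩
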